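/- For each $k\in\mathbb{N}$ let $G=G_k=(V,E)$ be a finite undirected simple graph with $n_v=|V|$ vertices; let $V^{(2)}$ be the set of unordered pairs of distinct vertices and $E^c=V^{(2)}\setminus E$. Let $(Y_{ij})_{\{i,j\}\in V^{(2)}}$ be independent $\{0,1\}$-valued random variables with $\mathbb{P}(Y_{ij}=1)=\alpha_{ij}$ for $\{i,j\}\in E^c$ and $\mathbb{P}(Y_{ij}=1)=1-\beta_{ij}$ for $\{i,j\}\in E$. Put $\hat E=\{\{i,j\}\in V^{(2)}:Y_{ij}=1\}$, $D_E=|\hat E|-|E|$ and $\sigma^2=\mathrm{Var}(D_E)$. All these objects depend on $k$, and asymptotic statements refer to $k\to\infty$. Let $\gamma\in[0,1)$ and $\kappa\ge 0$, and assume: (A1) $n_v\to\infty$; (A2) $|E|=\Theta(n_v\log n_v)$; (A3) $\sum_{\{i,j\}\in E^c}\alpha_{ij}=\sum_{\{i,j\}\in E}\beta_{ij}=:\lambda$; (A4) $\lambda=\Theta(n_v^{\gamma}\log^{\kappa}n_v)$; (A5) for each $k$ there are $\alpha,\beta\in(0,1)$ with $\alpha_{ij}=\alpha$ for all $\{i,j\}\in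 E^c$ and $\beta_{ij}=\beta$ for all $\{i,j\}\in E$. For random variables $X_1,X_2$ (or their laws) let $d_{KS}(X_1,X_2)=\sup_{x\in\mathbb{R}}|\mathbb{P}(X_1\le x)-\mathbb{P}(X_2\le x)|$. For $\lambda_1,\lambda_2>0$ let $\mathrm{Skellam}(\lambda_1,\lambda_2)$ be the law on $\mathbb{Z}$ that gives each $j\in\mathbb{Z}$ the mass $e^{-(\lambda_1+\lambda_2)}\bigl(\sqrt{\lambda_1/\lambda_2}\bigr)^{j}I_j(2\sqrt{\lambda_1\lambda_2})$, where $I_j$ is the modified Bessel function of the first kind. Then $$d_{KS}\bigl(D_E,\mathrm{Skellam}(\lambda,\lambda)\bigr)=O\Bigl(\bigl(n_v^{1-\gamma}\log^{1-\kappa}n_v\bigr)^{-1}\Bigr),$$ $$d_{KS}\bigl(D_E/\sigma,N(0,1)\bigr)=O\Bigl(\bigl(n_v^{\gamma/2}\log^{\kappa/2}n_v\bigr)^{-1}\Bigr),$$ and there is a constant $c>0$ such that, for all sufficiently large $k$ (hence large $n_v$), $$d_{KS}\bigl(D_E/\sigma,N(0,1)\bigr)\ge c\,(n_v\log n_v)^{-1}.$$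 -/

import Mathlib

open MeasureTheory ProbabilityTheory Filter Topology Asymptotics
open scoped NNReal ENNReal Nat

noncomputable section

namespace NoisyGraph

/-- Kolmogorov–Smirnov distance between two laws on the real line:
`sup_x |μ(-∞, x] - ν(-∞, x]|`. -/
def ksDist (μ ν : Measure ℝ) : ℝ :=
  ⨆ x : ℝ, |μ.real (Set.Iic x) - ν.real (Set.Iic x)|

/-- The modified Bessel function of the first kind of integer order `k`, by its power series
`I_k(x) = ∑_m (x/2)^(2m+|k|) / (m! (m+|k|)!)` (for integer orders, `I_{-k} = I_k`). -/
def besselI (k : ℤ) (x : ℝ) : ℝ :=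
  ∑' m : ℕ, (x / 2) ^ (2 * m + k.natAbs) / ((m ! : ℝ) * ((m + k.natAbs)! : ℝ))

/-- The Skellam probability of the integer `k`. -/
def skellamPMF (a b : ℝ) (k : ℤ) : ℝ :=
  Real.exp (-(a + b)) * √(a / b) ^ k * besselI k (2 * √(a * b))

/-- The Skellam distribution on the integers, with parameters `a, b > 0`. -/
def skellam (a b : ℝ) : Measure ℤ :=
  Measure.sum fun k : ℤ => ENNReal.ofReal (skellamPMF a b k) • Measure.dirac k

/-- The set `V^(2)` of unordered pairs of distinct vertices. -/
abbrev VPair (V : Type*) : Type _ := {e : Sym2 V // ¬ e.IsDiag}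

section Graph

variable {V : Type*} [Fintype V] [DecidableEq V]

open Classical in
/-- The edge set `E` of `G`, as a finite set of vertex pairs. -/
def edges (G : SimpleGraph V) : Finset (VPair V) :=
  {e : VPair V | e.1 ∈ G.edgeSet}

/-- The set of non-edges `E^c = V^(2) \ E` of `G`. -/
def nonEdges (G : SimpleGraph V) : Finset (VPair V) := Finset.univ \ edges G

variable {Ω : Type*}

/-- The inferred edge set `Ê`: the pairs that are declared to be edges. -/
def inferredEdges (Y : VPair V → Ω → Bool) (ω : Ω) : Finset (VPair V) :=
  {e : VPair V | Y e ω = true}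

/-- The discrepancy `D_E = |Ê| - |E|` of the edge counts. -/
def edgeDiscrepancy (G : SimpleGraph V) (Y : VPair V → Ω → Bool) (ω : Ω) : ℤ :=
  ((inferredEdges Y ω).card : ℤ) - ((edges G).card : ℤ)

variable [MeasurableSpace Ω]

/-- The standard deviation `σ` of the discrepancy `D_E`. -/
def sigma (P : Measure Ω) (G : SimpleGraph V) (Y : VPair V → Ω → Bool) : ℝ :=
  √(variance (fun ω => (edgeDiscrepancy G Y ω : ℝ)) P)

/-- The law of `D_E`, on the real line. -/
def lawD (P : Measure Ω) (G : SimpleGraph V) (Y : VPair V → Ω → Bool) : Measure ℝ :=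
  P.map fun ω => (edgeDiscrepancy G Y ω : ℝ)

/-- The law of `D_E / σ`. -/
def lawStandardizedD (P : Measure Ω) (G : SimpleGraph V) (Y : VPair V → Ω → Bool) : Measure ℝ :=
  P.map fun ω => (edgeDiscrepancy G Y ω : ℝ) / sigma P G Y

end Graph

/-- The power series of the Bessel function converges. -/
theorem summable_besselI (k : ℤ) (x : ℝ) :
    Summable fun m : ℕ =>
      (x / 2) ^ (2 * m + k.natAbs) / ((m ! : ℝ) * ((m + k.natAbs)! : ℝ)) := by
  have h := (Real.summable_pow_div_factorial ((x / 2) ^ 2)).mul_left (|x / 2| ^ k.natAbs)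
  refine h.of_norm_bounded fun m => ?_
  have h1 : (1 : ℝ) ≤ ((m + k.natAbs)! : ℝ) := by exact_mod_cast Nat.factorial_pos _
  have h2 : (0 : ℝ) < (m ! : ℝ) := by exact_mod_cast Nat.factorial_pos _
  rw [norm_div, norm_mul, norm_pow, Real.norm_eq_abs, Real.norm_natCast, Real.norm_natCast,
    pow_add, pow_mul, sq_abs, mul_comm, mul_div_assoc]
  gcongr
  nlinarith

/-- The Skellam distribution is the law of the difference of two independent Poisson
variables. -/
theorem skellam_eq_map_poisson (a b : ℝ≥0) (ha : 0 < a) (hb : 0 < b) :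
    skellam a b =
      ((poissonMeasure a).prod (poissonMeasure b)).map
        (fun p : ℕ × ℕ => (p.1 : ℤ) - (p.2 : ℤ)) := by
  refine Measure.ext_of_singleton fun k => ?_
  rw [skellam, Measure.sum_smul_dirac_singleton,
    Measure.map_apply (by fun_prop) (measurableSet_singleton k)]
  have hset : (fun p : ℕ × ℕ => (p.1 : ℤ) - (p.2 : ℤ)) ⁻¹' {k}
      = ⋃ m : ℕ, {((m + k.toNat, m + (-k).toNat) : ℕ × ℕ)} := by
    ext ⟨i, j⟩
    simp only [Set.mem_preimage, Set.mem_singleton_iff, Set.mem_iUnion, Prod.mk.injEq]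
    constructor
    · intro h
      exact ⟨min i j, by omega, by omega⟩
    · rintro ⟨m, h1, h2⟩
      omega
  rw [hset, measure_iUnion ?_ (fun _ => measurableSet_singleton _)]
  swap
  · intro m m' h
    simp only [Function.onFun, Set.disjoint_singleton, ne_eq, Prod.mk.injEq]
    omega
  have hterm : ∀ m : ℕ, ((poissonMeasure a).prod (poissonMeasure b))
      {((m + k.toNat, m + (-k).toNat) : ℕ × ℕ)} = ENNReal.ofReal
        (Real.exp (-((a : ℝ) + b)) * √((a : ℝ) / b) ^ k *
          ((2 * √((a : ℝ) * b) / 2) ^ (2 * m + k.natAbs) /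
            ((m ! : ℝ) * ((m + k.natAbs)! : ℝ)))) := by
    intro m
    rw [← Set.singleton_prod_singleton, Measure.prod_prod, poissonMeasure_singleton,
      poissonMeasure_singleton, ← ENNReal.ofReal_mul (by positivity)]
    congr 1
    have ha' : (0 : ℝ) < a := ha
    have hb' : (0 : ℝ) < b := hb
    obtain ⟨s, hs, hsa⟩ : ∃ s : ℝ, 0 < s ∧ (a : ℝ) = s ^ 2 :=
      ⟨√(a : ℝ), Real.sqrt_pos.2 ha', (Real.sq_sqrt ha'.le).symm⟩
    obtain ⟨t, ht, htb⟩ : ∃ t : ℝ, 0 < t ∧ (b : ℝ) = t ^ 2 :=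
      ⟨√(b : ℝ), Real.sqrt_pos.2 hb', (Real.sq_sqrt hb'.le).symm⟩
    rw [hsa, htb, ← div_pow, ← mul_pow, Real.sqrt_sq (by positivity),
      Real.sqrt_sq (by positivity), mul_div_cancel_left₀ _ (two_ne_zero), neg_add, Real.exp_add]
    obtain ⟨n, rfl | rfl⟩ := Int.eq_nat_or_neg k
    · have e1 : ((n : ℤ)).toNat = n := by omega
      have e2 : (-(n : ℤ)).toNat = 0 := by omega
      have e3 : ((n : ℤ)).natAbs = n := by omega
      rw [e1, e2, e3, zpow_natCast, add_zero, div_pow]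
      field_simp
      ring
    · have e1 : (-(n : ℤ)).toNat = 0 := by omega
      have e2 : (-(-(n : ℤ))).toNat = n := by omega
      have e3 : (-(n : ℤ)).natAbs = n := by omega
      rw [e1, e2, e3, zpow_neg, zpow_natCast, add_zero, div_pow]
      field_simp
      ring
  simp_rw [hterm]
  rw [← ENNReal.ofReal_tsum_of_nonneg (fun m => by positivity)
    ((summable_besselI k _).mul_left _), tsum_mul_left]
  rfl

end NoisyGraph

end

/-! The false positives and the false negatives are independent sums of Bernoulli variables, each of
mean λ, and D_E is their difference. The Skellam law is the difference of two independent Poisson(λ)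
variables, so the Stein–Chen method applied to each sum
(`IsBernoulliFamily.abs_cdf_sub_poissonCDF_le`) bounds the first distance by (∑ α² + ∑ β²)/λ, which
homogeneity turns into α + β. Eventually non-edges outnumber edges, hence α ≤ β = λ/|E|, and (A2)
and (A4) give the rate.

For the normal approximation, unbiasedness makes D_E the centred sum of all the Y_ij. Stein's method
gives the distance 12/σ (`IsBernoulliFamily.abs_cdf_sub_normalCDF_le`), and σ² = λ(1 - α) + λ(1 - β)
lies between λ and 2λ once α ≤ β ≤ 1/2. The kink of Stein's solution matters only when the sum with
one term left out takes one particular value; Stein's identity with an indicator as test function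
shows that this is rare (`IsBernoulliFamily.sum_prob_erase_eq_le`).

The lower bound holds because D_E is integer-valued: by Chebyshev at least 3/4 of its mass sits on
at most 4σ + 1 integers, while an atom weighs at most twice the distance to a continuous law
(`IsBernoulliFamily.le_of_abs_cdf_sub_normalCDF_le`). So the distance is at least 3/(8(4σ + 1)), and
σ ≤ n_v suffices for the claim. -/

namespace NoisyGraph

/-! ### Sums of independent Bernoulli variables and their Stein identities. -/

theorem integrable_comp_of_le {Ω : Type*} [MeasurableSpace Ω] {P : Measure Ω} [IsFiniteMeasure P]
    {X : Ω → ℕ} (hX : Measurable X) {N : ℕ} (hN : ∀ ω, X ω ≤ N) (u : ℕ → ℝ) :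
    Integrable (fun ω => u (X ω)) P := by
  refine Integrable.of_bound (C := ∑ i ∈ Finset.range (N + 1), |u i|)
    ((measurable_of_countable u).comp hX).aestronglyMeasurable (ae_of_all _ fun ω => ?_)
  exact Finset.single_le_sum (f := fun i => |u i|) (fun _ _ => abs_nonneg _)
    (Finset.mem_range.2 (Nat.lt_succ_of_le (hN ω)))

theorem sum_eq_add_sum_erase {Ω ι : Type*} [DecidableEq ι] {s : Finset ι} {Z : ι → Ω → ℕ}
    {e : ι} (he : e ∈ s) (ω : Ω) :
    ∑ i ∈ s, Z i ω = Z e ω + ∑ i ∈ s.erase e, Z i ω :=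
  (Finset.add_sum_erase s (fun i => Z i ω) he).symm

/-- Independent `{0,1}`-valued random variables, with `P (Z i = 1) = p i` for `i ∈ s`. -/
structure IsBernoulliFamily {Ω ι : Type*} [MeasurableSpace Ω] (P : Measure Ω) (s : Finset ι)
    (Z : ι → Ω → ℕ) (p : ι → ℝ) : Prop where
  measurable : ∀ i, Measurable (Z i)
  le_one : ∀ i ω, Z i ω ≤ 1
  iIndepFun : iIndepFun Z P
  prob : ∀ i ∈ s, P.real {ω | Z i ω = 1} = p i

namespace IsBernoulliFamily

variable {Ω ι : Type*} [MeasurableSpace Ω] {P : Measure Ω}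
  {s : Finset ι} {Z : ι → Ω → ℕ} {p : ι → ℝ}

theorem measurable_sum (h : IsBernoulliFamily P s Z p) (t : Finset ι) :
    Measurable fun ω => ∑ i ∈ t, Z i ω :=
  Finset.measurable_sum _ fun i _ => h.measurable i

theorem measurableSet_sum (h : IsBernoulliFamily P s Z p) (t : Finset ι) (q : ℕ → Prop) :
    MeasurableSet {ω | q (∑ i ∈ t, Z i ω)} :=
  h.measurable_sum t (MeasurableSet.of_discrete (s := {n | q n}))

theorem integral_ite_sum (h : IsBernoulliFamily P s Z p) (t : Finset ι) (q : ℕ → Prop)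
    [DecidablePred q] :
    ∫ ω, (if q (∑ i ∈ t, Z i ω) then (1 : ℝ) else 0) ∂P = P.real {ω | q (∑ i ∈ t, Z i ω)} := by
  rw [← integral_indicator_one (h.measurableSet_sum t q)]
  congr 1 with ω
  simp [Set.indicator]

theorem sum_le (h : IsBernoulliFamily P s Z p) (t : Finset ι) (ω : Ω) :
    ∑ i ∈ t, Z i ω ≤ t.card := by
  simpa using Finset.sum_le_sum (s := t) fun i _ => h.le_one i ω

theorem prob_nonneg (h : IsBernoulliFamily P s Z p) {e : ι} (he : e ∈ s) : 0 ≤ p e :=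
  h.prob e he ▸ measureReal_nonneg

theorem integral_eq (h : IsBernoulliFamily P s Z p) {e : ι} (he : e ∈ s) :
    ∫ ω, (Z e ω : ℝ) ∂P = p e := by
  have hset : MeasurableSet {ω | Z e ω = 1} := h.measurable e (measurableSet_singleton 1)
  rw [← h.prob e he, ← integral_indicator_one hset]
  congr 1 with ω
  have := h.le_one e ω
  by_cases h1 : Z e ω = 1
  · simp [h1]
  · have : Z e ω = 0 := by omega
    simp [this]

variable [IsProbabilityMeasure P]

theorem integrable_sum (h : IsBernoulliFamily P s Z p) (t : Finset ι) (u : ℕ → ℝ) :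
    Integrable (fun ω => u (∑ i ∈ t, Z i ω)) P :=
  integrable_comp_of_le (h.measurable_sum t) (h.sum_le t) u

theorem prob_le_one (h : IsBernoulliFamily P s Z p) {e : ι} (he : e ∈ s) : p e ≤ 1 :=
  h.prob e he ▸ measureReal_le_one

/-- Conditioning on one of the variables. -/
theorem integral_split (h : IsBernoulliFamily P s Z p) {e : ι} (he : e ∈ s) {t : Finset ι}
    (het : e ∉ t) (u : ℕ → ℕ → ℝ) :
    ∫ ω, u (Z e ω) (∑ i ∈ t, Z i ω) ∂P =
      (1 - p e) * ∫ ω, u 0 (∑ i ∈ t, Z i ω) ∂P + p e * ∫ ω, u 1 (∑ i ∈ t, Z i ω) ∂P := by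
  have hind : IndepFun (Z e) (fun ω => ∑ i ∈ t, Z i ω) P := by
    have := (h.iIndepFun.indepFun_finsetSum_of_notMem h.measurable het).symm
    convert this using 1
    ext ω
    simp
  have hmul : ∫ ω, (Z e ω : ℝ) * (u 1 (∑ i ∈ t, Z i ω) - u 0 (∑ i ∈ t, Z i ω)) ∂P =
      p e * ∫ ω, (u 1 (∑ i ∈ t, Z i ω) - u 0 (∑ i ∈ t, Z i ω)) ∂P := by
    rw [← h.integral_eq he]
    exact IndepFun.integral_fun_comp_mul_comp (f := fun n : ℕ => (n : ℝ))
      (g := fun n : ℕ => u 1 n - u 0 n) hind (h.measurable e).aemeasurable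
      (h.measurable_sum t).aemeasurable (measurable_of_countable _).aestronglyMeasurable
      (measurable_of_countable _).aestronglyMeasurable
  have hint : Integrable
      (fun ω => (Z e ω : ℝ) * (u 1 (∑ i ∈ t, Z i ω) - u 0 (∑ i ∈ t, Z i ω))) P := by
    refine (h.integrable_sum t fun n => u 1 n - u 0 n).bdd_mul (c := 1)
      ((measurable_of_countable (fun n : ℕ => (n : ℝ))).comp
        (h.measurable e)).aestronglyMeasurable (ae_of_all _ fun ω => ?_)
    simpa using h.le_one e ω
  have hpt : ∀ ω, u (Z e ω) (∑ i ∈ t, Z i ω) = u 0 (∑ i ∈ t, Z i ω) +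
      (Z e ω : ℝ) * (u 1 (∑ i ∈ t, Z i ω) - u 0 (∑ i ∈ t, Z i ω)) := by
    intro ω
    have := h.le_one e ω
    obtain h0 | h1 : Z e ω = 0 ∨ Z e ω = 1 := by omega
    · simp [h0]
    · simp [h1]
  simp_rw [hpt]
  rw [integral_add (h.integrable_sum t _) hint, hmul,
    integral_sub (h.integrable_sum t _) (h.integrable_sum t _)]
  ring

variable [DecidableEq ι]

/-- Stein's identity for a sum of independent Bernoulli variables. -/
theorem stein_identity (h : IsBernoulliFamily P s Z p) (g : ℕ → ℝ) :
    ∫ ω, ((∑ i ∈ s, Z i ω : ℕ) - ∑ i ∈ s, p i) * g (∑ i ∈ s, Z i ω) ∂P =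
      ∑ e ∈ s, p e * (1 - p e) *
        ∫ ω, (g (∑ i ∈ s.erase e, Z i ω + 1) - g (∑ i ∈ s.erase e, Z i ω)) ∂P := by
  have hpt : ∀ ω, ((∑ i ∈ s, Z i ω : ℕ) - ∑ i ∈ s, p i) * g (∑ i ∈ s, Z i ω) =
      ∑ e ∈ s, ((Z e ω : ℝ) - p e) * g (Z e ω + ∑ i ∈ s.erase e, Z i ω) := by
    intro ω
    push_cast
    rw [← Finset.sum_sub_distrib, Finset.sum_mul]
    exact Finset.sum_congr rfl fun e he => by rw [← sum_eq_add_sum_erase he ω]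
  simp_rw [hpt]
  rw [integral_finsetSum]
  · refine Finset.sum_congr rfl fun e he => ?_
    rw [h.integral_split he (Finset.notMem_erase e s)
        (fun a b => ((a : ℝ) - p e) * g (a + b)), integral_const_mul, integral_const_mul,
      integral_sub (h.integrable_sum _ fun n => g (n + 1)) (h.integrable_sum _ g)]
    simp_rw [Nat.add_comm 1]
    simp
    ring
  · intro e he
    simp_rw [← sum_eq_add_sum_erase he]
    refine (h.integrable_sum s g).bdd_mul (c := 1 + |p e|)
      ((measurable_of_countable (fun n : ℕ => (n : ℝ) - p e)).comp
        (h.measurable e)).aestronglyMeasurable (ae_of_all _ fun ω => ?_)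
    have := h.le_one e ω
    refine (abs_sub _ _).trans ?_
    gcongr
    simpa using this

/-- The Stein–Chen identity for a sum of independent Bernoulli variables. -/
theorem stein_chen_identity (h : IsBernoulliFamily P s Z p) (f : ℕ → ℝ) :
    ∫ ω, ((∑ i ∈ s, p i) * f (∑ i ∈ s, Z i ω + 1) -
        (∑ i ∈ s, Z i ω : ℕ) * f (∑ i ∈ s, Z i ω)) ∂P =
      ∑ e ∈ s, p e ^ 2 *
        ∫ ω, (f (∑ i ∈ s.erase e, Z i ω + 2) - f (∑ i ∈ s.erase e, Z i ω + 1)) ∂P := by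
  have hpt : ∀ ω, (∑ i ∈ s, p i) * f (∑ i ∈ s, Z i ω + 1) -
        (∑ i ∈ s, Z i ω : ℕ) * f (∑ i ∈ s, Z i ω) =
      ∑ e ∈ s, (p e * f (Z e ω + ∑ i ∈ s.erase e, Z i ω + 1) -
        (Z e ω : ℝ) * f (Z e ω + ∑ i ∈ s.erase e, Z i ω)) := by
    intro ω
    push_cast
    rw [Finset.sum_sub_distrib, Finset.sum_mul, Finset.sum_mul]
    exact congrArg₂ _ (Finset.sum_congr rfl fun e he => by rw [← sum_eq_add_sum_erase he ω])
      (Finset.sum_congr rfl fun e he => by rw [← sum_eq_add_sum_erase he ω])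
  simp_rw [hpt]
  rw [integral_finsetSum]
  · refine Finset.sum_congr rfl fun e he => ?_
    rw [h.integral_split he (Finset.notMem_erase e s)
        (fun a b => p e * f (a + b + 1) - (a : ℝ) * f (a + b)),
      integral_sub (h.integrable_sum _ fun n => f (n + 2)) (h.integrable_sum _ fun n => f (n + 1)),
      integral_sub, integral_sub]
    · simp_rw [Nat.add_comm 1, integral_const_mul]
      simp
      ring
    · exact h.integrable_sum _ fun n => p e * f (1 + n + 1)
    · exact h.integrable_sum _ fun n => ((1 : ℕ) : ℝ) * f (1 + n)
    · exact h.integrable_sum _ fun n => p e * f (0 + n + 1)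
    · exact h.integrable_sum _ fun n => ((0 : ℕ) : ℝ) * f (0 + n)
  · intro e he
    simp_rw [← sum_eq_add_sum_erase he]
    refine (h.integrable_sum s fun n => p e * f (n + 1)).sub
      ((h.integrable_sum s f).bdd_mul (c := 1)
      ((measurable_of_countable (fun n : ℕ => (n : ℝ))).comp
        (h.measurable e)).aestronglyMeasurable (ae_of_all _ fun ω => ?_))
    simpa using h.le_one e ω

/-- The variance of a sum of independent Bernoulli variables. -/
theorem integral_sub_mean_sq (h : IsBernoulliFamily P s Z p) :
    ∫ ω, (((∑ i ∈ s, Z i ω : ℕ) : ℝ) - ∑ i ∈ s, p i) ^ 2 ∂P = ∑ e ∈ s, p e * (1 - p e) := by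
  have := h.stein_identity fun n => (n : ℝ) - ∑ i ∈ s, p i
  simp_rw [pow_two]
  rw [this]
  simp

/-- Jensen's inequality, obtained from the nonnegative variance of the absolute deviation. -/
theorem integral_abs_sub_mean_le (h : IsBernoulliFamily P s Z p) :
    ∫ ω, |((∑ i ∈ s, Z i ω : ℕ) : ℝ) - ∑ i ∈ s, p i| ∂P ≤ √(∑ e ∈ s, p e * (1 - p e)) := by
  set μ := ∑ i ∈ s, p i
  set v := ∑ e ∈ s, p e * (1 - p e)
  set m := ∫ ω, |((∑ i ∈ s, Z i ω : ℕ) : ℝ) - μ| ∂P with hm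
  have hv : ∫ ω, (((∑ i ∈ s, Z i ω : ℕ) : ℝ) - μ) ^ 2 ∂P = v := h.integral_sub_mean_sq
  refine Real.le_sqrt_of_sq_le ?_
  have h0 : 0 ≤ ∫ ω, (|((∑ i ∈ s, Z i ω : ℕ) : ℝ) - μ| - m) ^ 2 ∂P :=
    integral_nonneg fun ω => sq_nonneg _
  have h1 : ∫ ω, (|((∑ i ∈ s, Z i ω : ℕ) : ℝ) - μ| - m) ^ 2 ∂P = v - m ^ 2 := by
    have : ∀ ω, (|((∑ i ∈ s, Z i ω : ℕ) : ℝ) - μ| - m) ^ 2 =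
        (((∑ i ∈ s, Z i ω : ℕ) : ℝ) - μ) ^ 2 -
          (2 * m * |((∑ i ∈ s, Z i ω : ℕ) : ℝ) - μ| - m ^ 2) := by
      intro ω
      rw [← sq_abs (((∑ i ∈ s, Z i ω : ℕ) : ℝ) - μ)]
      ring
    simp_rw [this]
    rw [integral_sub (h.integrable_sum s fun n => ((n : ℝ) - μ) ^ 2)
      (h.integrable_sum s fun n => 2 * m * |(n : ℝ) - μ| - m ^ 2),
      integral_sub (h.integrable_sum s fun n => 2 * m * |(n : ℝ) - μ|) (integrable_const _),
      integral_const_mul, hv, ← hm]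
    simp
    ring
  linarith

/-- The probability that a sum with one term left out takes a given value is `O(1/σ)`, on average
over the terms. -/
theorem sum_prob_erase_eq_le (h : IsBernoulliFamily P s Z p) (k : ℕ) :
    ∑ e ∈ s, p e * (1 - p e) * P.real {ω | ∑ i ∈ s.erase e, Z i ω = k} ≤
      √(∑ e ∈ s, p e * (1 - p e)) := by
  refine le_trans ?_ h.integral_abs_sub_mean_le
  -- The increments of this test function are the indicators of the value `k`, and the left side of
  -- the identity is at most the mean absolute deviation.
  have hs := h.stein_identity fun n => if k + 1 ≤ n then 1 else 0
  have hR : ∀ e ∈ s, p e * (1 - p e) * P.real {ω | ∑ i ∈ s.erase e, Z i ω = k} =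
      p e * (1 - p e) * ∫ ω, ((if k + 1 ≤ ∑ i ∈ s.erase e, Z i ω + 1 then (1 : ℝ) else 0) -
        if k + 1 ≤ ∑ i ∈ s.erase e, Z i ω then 1 else 0) ∂P := by
    intro e _
    rw [← h.integral_ite_sum _ fun n => n = k]
    congr 2 with ω
    split_ifs <;> first | omega | simp
  rw [Finset.sum_congr rfl hR, ← hs]
  refine integral_mono
    (h.integrable_sum s fun n => ((n : ℝ) - ∑ i ∈ s, p i) * if k + 1 ≤ n then 1 else 0)
    (h.integrable_sum s fun n => |(n : ℝ) - ∑ i ∈ s, p i|) fun ω => ?_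
  dsimp only
  split_ifs
  · rw [mul_one]
    exact le_abs_self _
  · simp

end IsBernoulliFamily
end NoisyGraph

/-! ### Stein–Chen method: Poisson approximation. -/

namespace NoisyGraph

section SteinChen

/-- The Poisson probability of `j`. -/
noncomputable def poissonProb (l : ℝ) (j : ℕ) : ℝ := Real.exp (-l) * l ^ j / j !

/-- The Poisson distribution function. -/
noncomputable def poissonCDF (l : ℝ) (k : ℕ) : ℝ := ∑ j ∈ Finset.range (k + 1), poissonProb l j

variable {l : ℝ}

theorem poissonProb_pos (hl : 0 < l) (j : ℕ) : 0 < poissonProb l j := by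
  unfold poissonProb; positivity

theorem poissonProb_succ (l : ℝ) (j : ℕ) :
    ((j : ℝ) + 1) * poissonProb l (j + 1) = l * poissonProb l j := by
  unfold poissonProb
  rw [Nat.factorial_succ]
  push_cast
  field_simp
  ring

theorem hasSum_poissonProb (l : ℝ) : HasSum (poissonProb l) 1 := by
  have h := (NormedSpace.expSeries_div_hasSum_exp l).mul_left (Real.exp (-l))
  rw [← Real.exp_eq_exp_ℝ, ← Real.exp_add, neg_add_cancel, Real.exp_zero] at h
  have e : poissonProb l = fun j => Real.exp (-l) * (l ^ j / j !) := by
    ext j; unfold poissonProb; ring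
  rwa [e]

theorem poissonCDF_succ (l : ℝ) (k : ℕ) :
    poissonCDF l (k + 1) = poissonCDF l k + poissonProb l (k + 1) :=
  Finset.sum_range_succ _ _

theorem poissonCDF_mono (hl : 0 < l) : Monotone (poissonCDF l) :=
  monotone_nat_of_le_succ fun k => by
    rw [poissonCDF_succ]; linarith [poissonProb_pos hl (k + 1)]

theorem poissonCDF_nonneg (hl : 0 < l) (k : ℕ) : 0 ≤ poissonCDF l k :=
  Finset.sum_nonneg fun j _ => (poissonProb_pos hl j).le

theorem one_sub_poissonCDF (l : ℝ) (k : ℕ) :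
    HasSum (fun i => poissonProb l (i + (k + 1))) (1 - poissonCDF l k) :=
  (hasSum_nat_add_iff' (k + 1)).2 (hasSum_poissonProb l)

theorem poissonCDF_le_one (hl : 0 < l) (k : ℕ) : poissonCDF l k ≤ 1 :=
  sub_nonneg.1 ((one_sub_poissonCDF l k).nonneg fun _ => (poissonProb_pos hl _).le)

/-- The upper tail of the Poisson distribution is small beyond the mean. -/
theorem sub_mul_one_sub_poissonCDF_le (hl : 0 < l) (j : ℕ) :
    ((j : ℝ) - l) * (1 - poissonCDF l j) ≤ l * poissonProb l j := by
  have h1 := one_sub_poissonCDF l j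
  have h2 : HasSum (fun i => poissonProb l (i + j)) (1 - poissonCDF l j + poissonProb l j) := by
    rw [← hasSum_nat_add_iff' 1]
    simpa [add_assoc, add_comm 1 j] using h1
  have h3 := (h2.mul_left l).sub (h1.mul_left l)
  -- Termwise comparison: `l * poissonProb l (i + j)` equals `(i + j + 1) * poissonProb l (i + j +
  -- 1)`, and the right-hand series sums to the single term `l * poissonProb l j`.
  refine (hasSum_le (fun i => ?_) (h1.mul_left ((j : ℝ) - l)) h3).trans (le_of_eq (by ring))
  have h4 := poissonProb_succ l (i + j)
  have h5 := poissonProb_pos hl (i + (j + 1))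
  rw [← add_assoc] at h5 ⊢
  push_cast at h4
  nlinarith [Nat.cast_nonneg (α := ℝ) i]

/-- The lower tail of the Poisson distribution is small below the mean. -/
theorem sub_mul_poissonCDF_le (hl : 0 < l) (j : ℕ) :
    (l - (j + 1)) * poissonCDF l j ≤ (j + 1) * poissonProb l (j + 1) := by
  induction j with
  | zero =>
    have h := poissonProb_succ l 0
    have h0 := poissonProb_pos hl 0
    simp [poissonCDF] at h ⊢
    nlinarith
  | succ j ih =>
    have h := poissonProb_succ l (j + 1)
    have h0 := poissonCDF_nonneg hl j
    have h1 := poissonProb_pos hl (j + 1)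
    rw [poissonCDF_succ]
    push_cast at h ⊢
    nlinarith

/-- The solution `f` of the Stein–Chen equation
`l * f (j + 1) - j * f j = 𝟙 (j ≤ k) - poissonCDF l k`. -/
noncomputable def steinChenSol (l : ℝ) (k : ℕ) : ℕ → ℝ
  | 0 => 0
  | j + 1 => poissonCDF l (min j k) * (1 - poissonCDF l (max j k)) / (l * poissonProb l j)

/-- The recursion `(j + 1) p (j + 1) = l p j` puts both terms over one denominator. The value of the
solution at 0 is immaterial, since its coefficient vanishes. -/
theorem steinChenSol_equation (hl : 0 < l) (k j : ℕ) :
    l * steinChenSol l k (j + 1) - j * steinChenSol l k j =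
      (if j ≤ k then 1 else 0) - poissonCDF l k := by
  cases j with
  | zero =>
    have h0 := poissonProb_pos hl 0
    simp [steinChenSol]
    simp [poissonCDF]
    field_simp
  | succ j =>
    have h0 := poissonProb_pos hl (j + 1)
    have h1 := poissonProb_succ l j
    simp only [steinChenSol]
    rw [← h1]
    push_cast
    have hj : (0 : ℝ) < j + 1 := by positivity
    split_ifs with h
    · rw [min_eq_left h, max_eq_right h, min_eq_left (by omega : j ≤ k),
        max_eq_right (by omega : j ≤ k), poissonCDF_succ]
      field_simp
      ring
    · push Not at h
      rw [min_eq_right h.le, max_eq_left h.le, min_eq_right (by omega : k ≤ j),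
        max_eq_left (by omega : k ≤ j), poissonCDF_succ]
      field_simp
      ring

/-- On each side of `k` the increment has a constant sign, by the tail bounds, and is largest in
size when `k` is adjacent (`k = j + 1` or `k = j`). There the tail bounds, split according to
whether `l ≤ j + 1`, give the estimate. -/
theorem abs_steinChenSol_sub_le (hl : 0 < l) (k j : ℕ) :
    |steinChenSol l k (j + 2) - steinChenSol l k (j + 1)| ≤ 1 / l := by
  have hp := poissonProb_pos hl (j + 1)
  have h1 := poissonProb_succ l j
  have hj : (0 : ℝ) < j + 1 := by positivity
  have hT := sub_mul_one_sub_poissonCDF_le hl (j + 1)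
  have hL := sub_mul_poissonCDF_le hl j
  have hF0 := poissonCDF_nonneg hl j
  have hF := poissonCDF_succ l j
  have hF1 := poissonCDF_le_one hl (j + 1)
  push_cast at hT
  have key : ∀ x c : ℝ, 0 ≤ x → 0 ≤ c → c * x ≤ (j + 1) * poissonProb l (j + 1) →
      |c * x / (l * ((j + 1) * poissonProb l (j + 1)))| ≤ 1 / l := by
    intro x c hx hc h
    rw [abs_of_nonneg (by positivity), div_le_div_iff₀ (by positivity) hl]
    nlinarith
  simp only [steinChenSol]
  rw [← h1]
  by_cases h : j + 1 ≤ k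
  · have hk : poissonCDF l (j + 1) ≤ poissonCDF l k := poissonCDF_mono hl h
    have hk1 := poissonCDF_le_one hl k
    rw [min_eq_left h, max_eq_right h, min_eq_left (by omega : j ≤ k),
        max_eq_right (by omega : j ≤ k)]
    -- The lower tail bound gives the sign; replacing `k` by `j + 1` then only enlarges the product.
    have hx : 0 ≤ (j + 1) * poissonCDF l (j + 1) - l * poissonCDF l j := by
      rw [hF]; linarith
    convert key ((j + 1) * poissonCDF l (j + 1) - l * poissonCDF l j) (1 - poissonCDF l k)
      hx (by linarith) ?_ using 2
    · field_simp
    · refine (mul_le_mul_of_nonneg_right (sub_le_sub_left hk 1) hx).trans ?_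
      have e : (1 - poissonCDF l (j + 1)) * ((j + 1) * poissonCDF l (j + 1) - l * poissonCDF l j) =
          (1 - poissonCDF l (j + 1)) * ((j + 1) * poissonProb l (j + 1)) +
            (j + 1 - l) * (1 - poissonCDF l (j + 1)) * poissonCDF l j := by
        rw [hF]; ring
      rw [e]
      obtain hlj | hlj := le_total l (j + 1)
      · have := mul_le_mul_of_nonneg_right hT hF0
        have : l * poissonProb l (j + 1) * poissonCDF l j ≤
            (j + 1) * poissonProb l (j + 1) * poissonCDF l j := by gcongr
        have : 0 ≤ (j + 1) * poissonProb l (j + 1) * poissonProb l (j + 1) := by positivity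
        rw [hF] at *
        nlinarith
      · have : 0 ≤ (l - (j + 1)) * ((1 - poissonCDF l (j + 1)) * poissonCDF l j) :=
          mul_nonneg (by linarith) (mul_nonneg (by linarith) hF0)
        have : 0 ≤ (j + 1) * poissonProb l (j + 1) * poissonCDF l (j + 1) :=
          mul_nonneg (by positivity) (by linarith)
        nlinarith
  · push Not at h
    have hk : poissonCDF l k ≤ poissonCDF l j := poissonCDF_mono hl (by omega)
    have hk0 := poissonCDF_nonneg hl k
    rw [min_eq_right h.le, max_eq_left h.le, min_eq_right (by omega : k ≤ j),
        max_eq_left (by omega : k ≤ j), abs_sub_comm]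
    have hx : 0 ≤ l * (1 - poissonCDF l j) - (j + 1) * (1 - poissonCDF l (j + 1)) := by
      rw [hF] at *; linarith
    convert key (l * (1 - poissonCDF l j) - (j + 1) * (1 - poissonCDF l (j + 1)))
      (poissonCDF l k) hx hk0 ?_ using 2
    · field_simp
    · refine (mul_le_mul_of_nonneg_right hk hx).trans ?_
      have e : poissonCDF l j * (l * (1 - poissonCDF l j) - (j + 1) * (1 - poissonCDF l (j + 1))) =
          poissonCDF l j * l * poissonProb l (j + 1) +
            (l - (j + 1)) * poissonCDF l j * (1 - poissonCDF l (j + 1)) := by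
        rw [hF]; ring
      rw [e]
      obtain hlj | hlj := le_total l (j + 1)
      · have : 0 ≤ ((j + 1) - l) * (poissonCDF l j * (1 - poissonCDF l (j + 1))) :=
          mul_nonneg (by linarith) (mul_nonneg hF0 (by linarith))
        have : poissonCDF l j * l * poissonProb l (j + 1) ≤
            1 * (j + 1) * poissonProb l (j + 1) := by
          gcongr
          linarith
        nlinarith
      · have h2 := mul_le_mul_of_nonneg_right hL (sub_nonneg.2 hF1)
        have h3 := mul_le_mul_of_nonneg_right hL hp.le
        rw [hF] at *
        nlinarith

theorem measureReal_poissonMeasure_Iic (r : ℝ≥0) (k : ℕ) :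
    (poissonMeasure r).real {i | i ≤ k} = poissonCDF r k := by
  have : {i | i ≤ k} = ((Finset.range (k + 1) : Finset ℕ) : Set ℕ) := by
    ext i; simp
  rw [this, ← sum_measureReal_singleton]
  refine Finset.sum_congr rfl fun j _ => ?_
  rw [measureReal_def, poissonMeasure_singleton, ENNReal.toReal_ofReal (by positivity)]
  rfl

/-- The Barbour–Hall bound for the Poisson approximation of a sum of independent Bernoulli
variables. -/
theorem IsBernoulliFamily.abs_cdf_sub_poissonCDF_le {Ω ι : Type*} [MeasurableSpace Ω]
    {P : Measure Ω} [IsProbabilityMeasure P] [DecidableEq ι] {s : Finset ι} {Z : ι → Ω → ℕ}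
    {p : ι → ℝ} (h : IsBernoulliFamily P s Z p) (hl : 0 < ∑ i ∈ s, p i) (k : ℕ) :
    |P.real {ω | ∑ i ∈ s, Z i ω ≤ k} - poissonCDF (∑ i ∈ s, p i) k| ≤
      (∑ i ∈ s, p i ^ 2) / ∑ i ∈ s, p i := by
  have hid := h.stein_chen_identity (steinChenSol (∑ i ∈ s, p i) k)
  -- The left side becomes the difference of the distribution functions at `k`; each increment on
  -- the right costs at most `1 / l`.
  simp_rw [steinChenSol_equation hl] at hid
  rw [integral_sub (h.integrable_sum s fun n => if n ≤ k then (1 : ℝ) else 0)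
    (integrable_const _)] at hid
  rw [h.integral_ite_sum s fun n => n ≤ k, integral_const, probReal_univ, one_smul] at hid
  rw [hid, Finset.sum_div]
  refine (Finset.abs_sum_le_sum_abs _ _).trans (Finset.sum_le_sum fun e he => ?_)
  rw [abs_mul, abs_of_nonneg (sq_nonneg _), div_eq_mul_one_div]
  gcongr
  rw [← Real.norm_eq_abs]
  refine (norm_integral_le_of_norm_le_const (C := 1 / ∑ i ∈ s, p i) (ae_of_all _ fun ω => ?_)).trans
    (by simp)
  exact abs_steinChenSol_sub_le hl k _

end SteinChen
end NoisyGraph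

/-! ### The normal law and the solution of Stein's equation. -/

namespace NoisyGraph

section NormalStein

/-- The standard normal density. -/
noncomputable def normalPDF (x : ℝ) : ℝ := gaussianPDFReal 0 1 x

/-- The standard normal distribution function. -/
noncomputable def normalCDF (x : ℝ) : ℝ := (gaussianReal 0 1).real (Set.Iic x)

theorem normalPDF_eq (x : ℝ) : normalPDF x = (√(2 * Real.pi))⁻¹ * Real.exp (-x ^ 2 / 2) := by
  simp [normalPDF, gaussianPDFReal]

theorem normalPDF_pos (x : ℝ) : 0 < normalPDF x := gaussianPDFReal_pos _ _ _ one_ne_zero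

theorem normalCDF_nonneg (x : ℝ) : 0 ≤ normalCDF x := measureReal_nonneg

theorem normalCDF_le_one (x : ℝ) : normalCDF x ≤ 1 := measureReal_le_one

theorem normalCDF_mono : Monotone normalCDF := fun _ _ h =>
  measureReal_mono (Set.Iic_subset_Iic.2 h)

theorem normalCDF_neg (x : ℝ) : normalCDF (-x) = 1 - normalCDF x := by
  have h : (gaussianReal 0 1).map (fun x => -x) = gaussianReal 0 1 := by
    simpa using gaussianReal_map_neg (μ := 0) (v := 1)
  have := nullSingletonClass_gaussianReal (μ := 0) (v := 1) one_ne_zero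
  unfold normalCDF
  rw [← probReal_compl_eq_one_sub measurableSet_Iic, Set.compl_Iic]
  conv_lhs => rw [← h]
  rw [map_measureReal_apply measurable_neg measurableSet_Iic]
  have e : (fun x : ℝ => -x) ⁻¹' Set.Iic (-x) = Set.Ici x := by ext; simp
  rw [e]
  exact measureReal_congr Ioi_ae_eq_Ici.symm

theorem hasDerivAt_normalPDF (x : ℝ) : HasDerivAt normalPDF (-x * normalPDF x) x := by
  have h : HasDerivAt (fun x : ℝ => (√(2 * Real.pi))⁻¹ * Real.exp (-x ^ 2 / 2))
      ((√(2 * Real.pi))⁻¹ * (Real.exp (-x ^ 2 / 2) * (-(2 * x) / 2))) x := by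
    refine HasDerivAt.const_mul _ (HasDerivAt.exp ?_)
    simpa using ((hasDerivAt_pow 2 x).neg.div_const 2)
  rw [funext normalPDF_eq]
  convert h using 1
  ring

theorem continuous_normalPDF : Continuous normalPDF :=
  continuous_iff_continuousAt.2 fun x => (hasDerivAt_normalPDF x).continuousAt

theorem hasDerivAt_normalCDF (x : ℝ) : HasDerivAt normalCDF (normalPDF x) x := by
  have hint : Integrable normalPDF := integrable_gaussianPDFReal 0 1
  have h1 : ∀ y, normalCDF y = normalCDF 0 + ∫ t in (0 : ℝ)..y, normalPDF t := by
    have hc : ∀ y, normalCDF y = ∫ t in Set.Iic y, normalPDF t := by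
      intro y
      unfold normalCDF
      rw [measureReal_def, gaussianReal_apply_eq_integral _ one_ne_zero, ENNReal.toReal_ofReal]
      · rfl
      · exact integral_nonneg fun t => (normalPDF_pos t).le
    intro y
    rw [hc, hc, ← intervalIntegral.integral_Iic_sub_Iic hint.integrableOn hint.integrableOn]
    ring
  rw [funext h1]
  exact (intervalIntegral.integral_hasDerivAt_right (continuous_normalPDF.intervalIntegrable _ _)
    (continuous_normalPDF.stronglyMeasurableAtFilter _ _) continuous_normalPDF.continuousAt).const_add _

theorem tendsto_normalPDF_atTop : Tendsto normalPDF atTop (𝓝 0) := by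
  have h : Tendsto (fun x : ℝ => (√(2 * Real.pi))⁻¹ * Real.exp (-(x ^ 2 / 2))) atTop
      (𝓝 ((√(2 * Real.pi))⁻¹ * 0)) :=
    (Real.tendsto_exp_neg_atTop_nhds_zero.comp
      ((tendsto_pow_atTop two_ne_zero).atTop_div_const two_pos)).const_mul _
  rw [mul_zero] at h
  refine h.congr fun x => ?_
  rw [normalPDF_eq]
  ring_nf

/-- The tail bound of Mills. -/
theorem mul_one_sub_normalCDF_le {x : ℝ} (hx : 0 < x) : x * (1 - normalCDF x) ≤ normalPDF x := by
  -- A function that increases on the positive axis with limit 0 at infinity is nonpositive.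
  have hmono : MonotoneOn (fun y => 1 - normalCDF y - normalPDF y / y) (Set.Ioi 0) := by
    have hd : ∀ y ∈ Set.Ioi (0 : ℝ), HasDerivAt (fun y => 1 - normalCDF y - normalPDF y / y)
        (normalPDF y / y ^ 2) y := by
      intro y hy
      have hy' : y ≠ 0 := (Set.mem_Ioi.1 hy).ne'
      refine HasDerivAt.congr_deriv (f := fun y => 1 - normalCDF y - normalPDF y / y)
        (((hasDerivAt_normalCDF y).const_sub 1).sub
          ((hasDerivAt_normalPDF y).div (hasDerivAt_id' y) hy')) ?_
      field_simp
      ring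
    refine monotoneOn_of_deriv_nonneg (convex_Ioi 0)
      (fun y hy => (hd y hy).continuousAt.continuousWithinAt) ?_ ?_
    · rw [interior_Ioi]
      exact fun y hy => (hd y hy).differentiableAt.differentiableWithinAt
    · rw [interior_Ioi]
      intro y hy
      rw [(hd y hy).deriv]
      exact div_nonneg (normalPDF_pos y).le (sq_nonneg y)
  have hlim : Tendsto (fun y => 1 - normalCDF y - normalPDF y / y) atTop (𝓝 (1 - 1 - 0)) := by
    refine (Tendsto.const_sub _ ?_).sub (tendsto_normalPDF_atTop.div_atTop tendsto_id)
    have := tendsto_measure_Iic_atTop (gaussianReal 0 1)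
    rw [measure_univ] at this
    exact (ENNReal.tendsto_toReal ENNReal.one_ne_top).comp this
  have h0 : 1 - normalCDF x - normalPDF x / x ≤ 0 := by
    refine ge_of_tendsto (by simpa using hlim) ?_
    filter_upwards [eventually_ge_atTop x] with y hy
    exact hmono hx (Set.mem_Ioi.2 (hx.trans_le hy)) hy
  rw [sub_nonpos, le_div_iff₀ hx] at h0
  linarith

/-- Mills' bound covers `1 ≤ x`. On `[0, 1]` the density is at least `1/3 * 1/2`, whence the 6. -/
theorem one_sub_normalCDF_le {x : ℝ} (hx : 0 ≤ x) : 1 - normalCDF x ≤ 6 * normalPDF x := by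
  have hp := normalPDF_pos x
  obtain h | h := le_total 1 x
  · have := mul_one_sub_normalCDF_le (zero_lt_one.trans_le h)
    nlinarith [normalCDF_le_one x]
  · suffices 1 ≤ 6 * normalPDF x by linarith [normalCDF_nonneg x]
    have h1 : √(2 * Real.pi) ≤ 3 := by
      rw [Real.sqrt_le_left (by norm_num)]
      linarith [Real.pi_lt_four]
    have h2 : (1 : ℝ) / 2 ≤ Real.exp (-x ^ 2 / 2) := by
      have := Real.add_one_le_exp (-x ^ 2 / 2)
      nlinarith
    have h3 : (3 : ℝ)⁻¹ ≤ (√(2 * Real.pi))⁻¹ := inv_anti₀ (by positivity) h1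
    rw [normalPDF_eq]
    nlinarith

/-- The lower branch of the solution of Stein's equation. -/
noncomputable def steinLeft (x w : ℝ) : ℝ := normalCDF w * (1 - normalCDF x) / normalPDF w

/-- The upper branch of the solution of Stein's equation. -/
noncomputable def steinRight (x w : ℝ) : ℝ := normalCDF x * (1 - normalCDF w) / normalPDF w

open Classical in
/-- The solution `f` of Stein's equation `f' w - w * f w = 𝟙 (w ≤ x) - Φ x`. -/
noncomputable def steinSol (x w : ℝ) : ℝ := if w ≤ x then steinLeft x w else steinRight x w

open Classical in
/-- The derivative of `steinSol x`, off `x`. -/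
noncomputable def steinDeriv (x w : ℝ) : ℝ :=
  w * steinSol x w + (if w ≤ x then 1 else 0) - normalCDF x

theorem hasDerivAt_steinLeft (x w : ℝ) :
    HasDerivAt (steinLeft x) (w * steinLeft x w + 1 - normalCDF x) w := by
  have hp := (normalPDF_pos w).ne'
  refine HasDerivAt.congr_deriv (f := steinLeft x)
    (((hasDerivAt_normalCDF w).mul_const (1 - normalCDF x)).div (hasDerivAt_normalPDF w) hp) ?_
  unfold steinLeft
  field_simp
  ring

theorem hasDerivAt_steinRight (x w : ℝ) :
    HasDerivAt (steinRight x) (w * steinRight x w - normalCDF x) w := by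
  have hp := (normalPDF_pos w).ne'
  refine HasDerivAt.congr_deriv (f := steinRight x)
    ((((hasDerivAt_normalCDF w).const_sub 1).const_mul (normalCDF x)).div
      (hasDerivAt_normalPDF w) hp) ?_
  unfold steinRight
  field_simp
  ring

theorem normalPDF_neg (x : ℝ) : normalPDF (-x) = normalPDF x := by
  rw [normalPDF_eq, normalPDF_eq, neg_sq]

/-- Merging the branches spares most bounds on the solution a case split at `x`. -/
theorem steinSol_mul_normalPDF (x w : ℝ) : steinSol x w * normalPDF w =
    normalCDF (min w x) * (1 - normalCDF (max w x)) := by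
  have hp := (normalPDF_pos w).ne'
  unfold steinSol steinLeft steinRight
  split_ifs with h
  · rw [min_eq_left h, max_eq_right h]; field_simp
  · rw [min_eq_right (le_of_not_ge h), max_eq_left (le_of_not_ge h)]; field_simp

theorem steinSol_nonneg (x w : ℝ) : 0 ≤ steinSol x w := by
  refine nonneg_of_mul_nonneg_left ?_ (normalPDF_pos w)
  rw [steinSol_mul_normalPDF]
  exact mul_nonneg (normalCDF_nonneg _) (sub_nonneg.2 (normalCDF_le_one _))

/-- `steinSol x w` is at most the Mills ratio at `|w|`. -/
theorem steinSol_mul_normalPDF_le (x w : ℝ) :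
    steinSol x w * normalPDF w ≤ 1 - normalCDF |w| := by
  rw [steinSol_mul_normalPDF]
  obtain h | h := le_total 0 w
  · rw [abs_of_nonneg h]
    have h1 := normalCDF_mono (le_max_left w x)
    nlinarith [normalCDF_le_one (min w x), normalCDF_le_one (max w x), normalCDF_nonneg (min w x)]
  · rw [abs_of_nonpos h, normalCDF_neg, sub_sub_cancel]
    have h1 := normalCDF_mono (min_le_left w x)
    nlinarith [normalCDF_nonneg (max w x), normalCDF_le_one (max w x), normalCDF_nonneg (min w x)]

theorem normalPDF_abs (w : ℝ) : normalPDF |w| = normalPDF w := by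
  obtain h | h := le_total 0 w
  · rw [abs_of_nonneg h]
  · rw [abs_of_nonpos h, normalPDF_neg]

theorem steinSol_le (x w : ℝ) : steinSol x w ≤ 6 := by
  have h := (steinSol_mul_normalPDF_le x w).trans (one_sub_normalCDF_le (abs_nonneg w))
  rw [normalPDF_abs] at h
  exact le_of_mul_le_mul_right h (normalPDF_pos w)

theorem abs_mul_steinSol_le (x w : ℝ) : |w * steinSol x w| ≤ 1 := by
  rw [abs_mul, abs_of_nonneg (steinSol_nonneg x w)]
  obtain h | h := (abs_nonneg w).eq_or_lt
  · simp [← h]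
  · refine le_of_mul_le_mul_right ?_ (normalPDF_pos w)
    rw [one_mul, mul_assoc]
    refine (mul_le_mul_of_nonneg_left (steinSol_mul_normalPDF_le x w) h.le).trans ?_
    exact (mul_one_sub_normalCDF_le h).trans_eq (normalPDF_abs w)

theorem abs_steinDeriv_le (x w : ℝ) : |steinDeriv x w| ≤ 2 := by
  have h := abs_le.1 (abs_mul_steinSol_le x w)
  unfold steinDeriv
  rw [abs_le]
  have h1 := normalCDF_nonneg x
  have h2 := normalCDF_le_one x
  split_ifs <;> constructor <;> linarith

/-- The solution has a kink at `x`, so the mean value theorem is used only on intervals that do not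
straddle it. -/
theorem exists_steinSol_sub_eq_of_le {x a b : ℝ} (hab : a < b) (hb : b ≤ x) :
    ∃ ξ ∈ Set.Ioo a b, steinSol x b - steinSol x a = (b - a) * steinDeriv x ξ := by
  obtain ⟨ξ, hξ, h⟩ := exists_hasDerivAt_eq_slope (steinLeft x) _ hab
    (fun w _ => (hasDerivAt_steinLeft x w).continuousAt.continuousWithinAt)
    (fun w _ => hasDerivAt_steinLeft x w)
  refine ⟨ξ, hξ, ?_⟩
  unfold steinDeriv steinSol
  rw [if_pos hb, if_pos (hab.le.trans hb), if_pos (hξ.2.le.trans hb), if_pos (hξ.2.le.trans hb), h,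
    mul_div_cancel₀ _ (sub_pos.2 hab).ne']

theorem exists_steinSol_sub_eq_of_ge {x a b : ℝ} (hab : a < b) (ha : x ≤ a) :
    ∃ ξ ∈ Set.Ioo a b, steinSol x b - steinSol x a = (b - a) * steinDeriv x ξ := by
  obtain ⟨ξ, hξ, h⟩ := exists_hasDerivAt_eq_slope (steinRight x) _ hab
    (fun w _ => (hasDerivAt_steinRight x w).continuousAt.continuousWithinAt)
    (fun w _ => hasDerivAt_steinRight x w)
  refine ⟨ξ, hξ, ?_⟩
  have hx : ∀ w, x ≤ w → steinSol x w = steinRight x w := by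
    intro w hw
    unfold steinSol
    split_ifs with h
    · rw [le_antisymm h hw]; rfl
    · rfl
  have hξ' : ¬ ξ ≤ x := not_le.2 (ha.trans_lt hξ.1)
  unfold steinDeriv
  rw [if_neg hξ', add_zero, hx _ (ha.trans hab.le), hx _ ha, hx _ (ha.trans hξ.1.le), h,
    mul_div_cancel₀ _ (sub_pos.2 hab).ne']

theorem abs_steinSol_sub_le (x : ℝ) {a b : ℝ} (hab : a ≤ b) :
    |steinSol x b - steinSol x a| ≤ 2 * (b - a) := by
  have h1 : ∀ a b, a ≤ b → b ≤ x → |steinSol x b - steinSol x a| ≤ 2 * (b - a) := by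
    intro a b hab hb
    obtain rfl | hab := hab.eq_or_lt
    · simp
    · obtain ⟨ξ, -, h⟩ := exists_steinSol_sub_eq_of_le hab hb
      rw [h, abs_mul, abs_of_pos (sub_pos.2 hab), mul_comm]
      exact mul_le_mul_of_nonneg_right (abs_steinDeriv_le x ξ) (sub_pos.2 hab).le
  have h2 : ∀ a b, a ≤ b → x ≤ a → |steinSol x b - steinSol x a| ≤ 2 * (b - a) := by
    intro a b hab ha
    obtain rfl | hab := hab.eq_or_lt
    · simp
    · obtain ⟨ξ, -, h⟩ := exists_steinSol_sub_eq_of_ge hab ha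
      rw [h, abs_mul, abs_of_pos (sub_pos.2 hab), mul_comm]
      exact mul_le_mul_of_nonneg_right (abs_steinDeriv_le x ξ) (sub_pos.2 hab).le
  obtain hb | hb := le_total b x
  · exact h1 a b hab hb
  obtain ha | ha := le_total x a
  · exact h2 a b hab ha
  · have := abs_sub_le (steinSol x b) (steinSol x x) (steinSol x a)
    linarith [h1 a x ha le_rfl, h2 x b hb le_rfl]

theorem abs_steinSol_sub_le' (x a b : ℝ) : |steinSol x b - steinSol x a| ≤ 2 * |b - a| := by
  obtain h | h := le_total a b
  · rw [abs_of_nonneg (sub_nonneg.2 h)]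
    exact abs_steinSol_sub_le x h
  · rw [abs_sub_comm, abs_sub_comm b, abs_of_nonneg (sub_nonneg.2 h)]
    exact abs_steinSol_sub_le x h

/-- A difference quotient of the solution of Stein's equation is close to its derivative. -/
theorem abs_steinSol_sub_sub_le {x a b w : ℝ} (hab : a < b) (hw : w ∈ Set.Icc a b)
    (hx : b ≤ x ∨ x < a) :
    |steinSol x b - steinSol x a - (b - a) * steinDeriv x w| ≤
      (b - a) ^ 2 * (6 + 2 * |w|) := by
  obtain ⟨ξ, hξ, h, hi⟩ : ∃ ξ ∈ Set.Ioo a b,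
      -- The indicator in `steinDeriv` must agree at `ξ` and `w`. This is why `x < a` is strict: `w
      -- = a = x` would fall on the other side from `ξ`.
      steinSol x b - steinSol x a = (b - a) * steinDeriv x ξ ∧ (ξ ≤ x ↔ w ≤ x) := by
    obtain hx | hx := hx
    · obtain ⟨ξ, hξ, h⟩ := exists_steinSol_sub_eq_of_le hab hx
      exact ⟨ξ, hξ, h, iff_of_true (hξ.2.le.trans hx) (hw.2.trans hx)⟩
    · obtain ⟨ξ, hξ, h⟩ := exists_steinSol_sub_eq_of_ge hab hx.le
      exact ⟨ξ, hξ, h, iff_of_false (not_le.2 (hx.trans hξ.1)) (not_le.2 (hx.trans_le hw.1))⟩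
  have hd : |ξ - w| ≤ b - a := by
    rw [abs_le]
    constructor <;> linarith [hw.1, hw.2, hξ.1, hξ.2]
  -- Stein's equation replaces a second derivative: the indicators cancel and only the increment of
  -- `w * steinSol x w` remains.
  have e : steinSol x b - steinSol x a - (b - a) * steinDeriv x w =
      (b - a) * ((ξ - w) * steinSol x ξ + w * (steinSol x ξ - steinSol x w)) := by
    rw [h]
    unfold steinDeriv
    simp only [hi]
    ring
  have hs := steinSol_le x ξ
  have hs0 := steinSol_nonneg x ξ
  rw [e, abs_mul, abs_of_pos (sub_pos.2 hab), pow_two, mul_assoc]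
  refine mul_le_mul_of_nonneg_left ((abs_add_le _ _).trans ?_) (sub_pos.2 hab).le
  rw [abs_mul, abs_mul, abs_of_nonneg hs0, mul_add]
  refine add_le_add (by gcongr) ?_
  rw [mul_left_comm, mul_comm (b - a)]
  have := abs_steinSol_sub_le' x w ξ
  calc |w| * |steinSol x ξ - steinSol x w| ≤ |w| * (2 * (b - a)) := by
        gcongr; linarith
    _ = 2 * (|w| * (b - a)) := by ring

end NormalStein
end NoisyGraph

/-! ### Berry–Esseen bound and its lattice converse. -/

namespace NoisyGraph

namespace IsBernoulliFamily

variable {Ω ι : Type*} [MeasurableSpace Ω] {P : Measure Ω} [IsProbabilityMeasure P]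
  [DecidableEq ι] {s : Finset ι} {Z : ι → Ω → ℕ} {p : ι → ℝ}

/-- The Berry–Esseen bound for a sum of independent Bernoulli variables. -/
theorem abs_cdf_sub_normalCDF_le (h : IsBernoulliFamily P s Z p) {σ : ℝ} (hσ : 0 < σ)
    (hv : ∑ e ∈ s, p e * (1 - p e) = σ ^ 2) (x : ℝ) :
    |P.real {ω | ((∑ i ∈ s, Z i ω : ℕ) - ∑ i ∈ s, p i) / σ ≤ x} - normalCDF x| ≤ 12 / σ := by
  classical
  set μ := ∑ i ∈ s, p i with hμ
  set W : ℕ → ℝ := fun n => (n - μ) / σ with hW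
  have hW1 : ∀ n, W (n + 1) - W n = 1 / σ := by
    intro n
    simp only [hW]
    push_cast
    ring
  -- The only `n` for which `x` can separate `W n` from `W (n + 1)`. If the argument is negative the
  -- floor is 0, which merely excludes a harmless value.
  set k : ℕ := ⌊x * σ + μ⌋₊
  have hk : ∀ n, n ≠ k → W (n + 1) ≤ x ∨ x < W n := by
    intro n hn
    by_contra! hcon
    obtain ⟨h1, h2⟩ := hcon
    simp only [hW] at h1 h2
    rw [lt_div_iff₀ hσ] at h1
    rw [div_le_iff₀ hσ] at h2
    push_cast at h1
    refine hn ((Nat.floor_eq_iff (le_trans (Nat.cast_nonneg n) (by linarith))).2 ⟨?_, ?_⟩).symm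
    · linarith
    · linarith
  -- Stein's equation integrated, with the term `w * f w` rewritten by Stein's identity.
  have hE : P.real {ω | ((∑ i ∈ s, Z i ω : ℕ) - μ) / σ ≤ x} - normalCDF x =
      ∫ ω, steinDeriv x (W (∑ i ∈ s, Z i ω)) ∂P - 1 / σ * ∑ e ∈ s, p e * (1 - p e) *
        ∫ ω, (steinSol x (W (∑ i ∈ s.erase e, Z i ω + 1)) -
          steinSol x (W (∑ i ∈ s.erase e, Z i ω))) ∂P := by
    rw [← h.stein_identity fun n => steinSol x (W n), ← integral_const_mul,
      ← integral_sub (h.integrable_sum s fun n => steinDeriv x (W n))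
        (h.integrable_sum s fun n => 1 / σ * ((n - μ) * steinSol x (W n)))]
    have hset : MeasurableSet {ω | ((∑ i ∈ s, Z i ω : ℕ) - μ) / σ ≤ x} :=
      h.measurableSet_sum s fun n => ((n : ℝ) - μ) / σ ≤ x
    rw [← integral_indicator_one hset]
    have hc : normalCDF x = ∫ _ω, normalCDF x ∂P := by simp
    rw [hc, ← integral_sub ((integrable_const 1).indicator hset) (integrable_const _)]
    congr 1 with ω
    simp only [Set.indicator, Set.mem_ofPred_eq, Pi.one_apply, steinDeriv, hW]
    ring
  -- Away from `k` the smooth estimate applies; at `k` the derivative and the scaled increment, each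
  -- at most 2, give the 4.
  have hpt : ∀ e ∈ s, ∀ ω, |steinDeriv x (W (∑ i ∈ s, Z i ω)) -
      σ * (steinSol x (W (∑ i ∈ s.erase e, Z i ω + 1)) -
          steinSol x (W (∑ i ∈ s.erase e, Z i ω)))| ≤
      1 / σ * (6 + 2 * |W (∑ i ∈ s, Z i ω)|) +
        4 * if ∑ i ∈ s.erase e, Z i ω = k then 1 else 0 := by
    intro e he ω
    set n := ∑ i ∈ s.erase e, Z i ω
    set N := ∑ i ∈ s, Z i ω with hN
    have hNn : N = n ∨ N = n + 1 := by
      have h1 := h.le_one e ω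
      have h2 := sum_eq_add_sum_erase (Z := Z) he ω
      omega
    have hlt : W n < W (n + 1) := by
      have := hW1 n
      have : 0 < 1 / σ := by positivity
      linarith
    by_cases hnk : n = k
    · rw [if_pos hnk]
      have h1 := abs_steinDeriv_le x (W N)
      have h2 := abs_steinSol_sub_le x hlt.le
      rw [hW1] at h2
      have h3 : |σ * (steinSol x (W (n + 1)) - steinSol x (W n))| ≤ 2 := by
        rw [abs_mul, abs_of_pos hσ]
        calc _ ≤ σ * (2 * (1 / σ)) := by gcongr
          _ = 2 := by field_simp
      have h4 : 0 ≤ 1 / σ * (6 + 2 * |W N|) := by positivity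
      have := abs_sub (steinDeriv x (W N)) (σ * (steinSol x (W (n + 1)) - steinSol x (W n)))
      linarith
    · rw [if_neg hnk, mul_zero, add_zero]
      have hw : W N ∈ Set.Icc (W n) (W (n + 1)) := by
        obtain hc | hc := hNn <;> rw [hc]
        · exact ⟨le_rfl, hlt.le⟩
        · exact ⟨hlt.le, le_rfl⟩
      have h1 := abs_steinSol_sub_sub_le hlt hw (hk n hnk)
      rw [hW1] at h1
      have e1 : steinDeriv x (W N) - σ * (steinSol x (W (n + 1)) - steinSol x (W n)) =
          -σ * (steinSol x (W (n + 1)) - steinSol x (W n) - 1 / σ * steinDeriv x (W N)) := by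
        field_simp
        ring
      rw [e1, abs_mul, abs_neg, abs_of_pos hσ]
      calc _ ≤ σ * ((1 / σ) ^ 2 * (6 + 2 * |W N|)) := by gcongr
        _ = _ := by field_simp
  have hmean : ∫ ω, |W (∑ i ∈ s, Z i ω)| ∂P ≤ 1 := by
    have h1 := h.integral_abs_sub_mean_le
    rw [hv, Real.sqrt_sq hσ.le] at h1
    simp only [hW, abs_div, abs_of_pos hσ]
    rw [integral_div, div_le_one hσ]
    exact h1
  have hterm : ∀ e ∈ s, |∫ ω, steinDeriv x (W (∑ i ∈ s, Z i ω)) ∂P -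
      σ * ∫ ω, (steinSol x (W (∑ i ∈ s.erase e, Z i ω + 1)) -
          steinSol x (W (∑ i ∈ s.erase e, Z i ω))) ∂P| ≤
      8 / σ + 4 * P.real {ω | ∑ i ∈ s.erase e, Z i ω = k} := by
    intro e he
    rw [← integral_const_mul, ← integral_sub (h.integrable_sum s fun n => steinDeriv x (W n))
      (h.integrable_sum (s.erase e) fun n => σ * (steinSol x (W (n + 1)) - steinSol x (W n)))]
    have hi1 := h.integrable_sum s fun n => 1 / σ * (6 + 2 * |W n|)
    have hi2 := h.integrable_sum (s.erase e) fun n => 4 * if n = k then (1 : ℝ) else 0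
    rw [← Real.norm_eq_abs]
    refine (norm_integral_le_of_norm_le (hi1.add hi2) (ae_of_all _ fun ω => hpt e he ω)).trans ?_
    simp only [Pi.add_apply]
    rw [integral_add hi1 hi2, integral_const_mul, integral_const_mul,
      h.integral_ite_sum (s.erase e) fun n => n = k,
      integral_add (integrable_const _) (h.integrable_sum s fun n => 2 * |W n|), integral_const_mul]
    gcongr
    simp only [integral_const, probReal_univ, one_smul]
    rw [div_eq_mul_one_div 8, mul_comm 8]
    gcongr
    linarith
  -- The weights `p e * (1 - p e) / σ ^ 2` add up to 1, so the error is an average over the omitted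
  -- term.
  have hsplit : P.real {ω | ((∑ i ∈ s, Z i ω : ℕ) - μ) / σ ≤ x} - normalCDF x =
      1 / σ ^ 2 * ∑ e ∈ s, p e * (1 - p e) * (∫ ω, steinDeriv x (W (∑ i ∈ s, Z i ω)) ∂P -
      σ * ∫ ω, (steinSol x (W (∑ i ∈ s.erase e, Z i ω + 1)) -
          steinSol x (W (∑ i ∈ s.erase e, Z i ω))) ∂P) := by
    rw [hE]
    simp_rw [mul_sub (p _ * (1 - p _)), Finset.sum_sub_distrib]
    rw [← Finset.sum_mul, hv]
    simp_rw [mul_left_comm _ σ]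
    rw [← Finset.mul_sum]
    field_simp
  have hc : ∀ e ∈ s, 0 ≤ p e * (1 - p e) := fun e he =>
    mul_nonneg (h.prob_nonneg he) (sub_nonneg.2 (h.prob_le_one he))
  have hconc := h.sum_prob_erase_eq_le k
  rw [hv, Real.sqrt_sq hσ.le] at hconc
  rw [hsplit, abs_mul, abs_of_pos (by positivity)]
  calc _ ≤ 1 / σ ^ 2 * ∑ e ∈ s, (p e * (1 - p e) * (8 / σ) +
          4 * (p e * (1 - p e) * P.real {ω | ∑ i ∈ s.erase e, Z i ω = k})) := by
        gcongr
        refine (Finset.abs_sum_le_sum_abs _ _).trans (Finset.sum_le_sum fun e he => ?_)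
        rw [abs_mul, abs_of_nonneg (hc e he)]
        refine (mul_le_mul_of_nonneg_left (hterm e he) (hc e he)).trans_eq ?_
        ring
    _ ≤ 1 / σ ^ 2 * (σ ^ 2 * (8 / σ) + 4 * σ) := by
        rw [Finset.sum_add_distrib, ← Finset.sum_mul, hv, ← Finset.mul_sum]
        gcongr
    _ = 12 / σ := by field_simp; norm_num

/-- The distribution function of a lattice variable cannot be too close to a continuous one. -/
theorem le_of_abs_cdf_sub_normalCDF_le (h : IsBernoulliFamily P s Z p) {σ δ : ℝ} (hσ : 0 < σ)
    (hv : ∑ e ∈ s, p e * (1 - p e) = σ ^ 2)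
    (hδ : ∀ x, |P.real {ω | ((∑ i ∈ s, Z i ω : ℕ) - ∑ i ∈ s, p i) / σ ≤ x} - normalCDF x| ≤ δ) :
    3 / 4 ≤ (4 * σ + 1) * (2 * δ) := by
  classical
  set μ := ∑ i ∈ s, p i with hμ
  have hδ0 : 0 ≤ δ := (abs_nonneg _).trans (hδ 0)
  -- An atom is a jump of the distribution function. Comparing at the atom and at `y` below it costs
  -- `2 * δ`, and the normal increment vanishes as `y` tends to the atom.
  have hatom : ∀ k : ℤ, P.real {ω | ((∑ i ∈ s, Z i ω : ℕ) : ℤ) = k} ≤ 2 * δ := by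
    intro k
    have hε : ∀ y < ((k : ℝ) - μ) / σ, P.real {ω | ((∑ i ∈ s, Z i ω : ℕ) : ℤ) = k} ≤
        2 * δ + (normalCDF (((k : ℝ) - μ) / σ) - normalCDF y) := by
      intro y hy
      have hadd : P.real {ω | ((∑ i ∈ s, Z i ω : ℕ) : ℤ) = k} +
          P.real {ω | ((∑ i ∈ s, Z i ω : ℕ) - μ) / σ ≤ y} ≤
          P.real {ω | ((∑ i ∈ s, Z i ω : ℕ) - μ) / σ ≤ ((k : ℝ) - μ) / σ} := by
        rw [← measureReal_union _ (h.measurableSet_sum s fun n => ((n : ℝ) - μ) / σ ≤ y)]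
        · refine measureReal_mono ?_
          rintro ω (hω | hω)
          · have : ((∑ i ∈ s, Z i ω : ℕ) : ℝ) = k := by
              exact_mod_cast congrArg (Int.cast : ℤ → ℝ) hω
            exact (congrArg (fun t : ℝ => (t - μ) / σ) this).le
          · have h2 : ((∑ i ∈ s, Z i ω : ℕ) - μ) / σ ≤ y := hω
            exact h2.trans hy.le
        · rw [Set.disjoint_left]
          intro ω hω hω'
          have : ((∑ i ∈ s, Z i ω : ℕ) : ℝ) = k := by
            exact_mod_cast congrArg (Int.cast : ℤ → ℝ) hω
          have h2 : ((∑ i ∈ s, Z i ω : ℕ) - μ) / σ ≤ y := hω'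
          rw [this] at h2
          linarith
      have h1 := abs_le.1 (hδ (((k : ℝ) - μ) / σ))
      have h2 := abs_le.1 (hδ y)
      linarith [h1.2, h2.1]
    have hcont := (hasDerivAt_normalCDF (((k : ℝ) - μ) / σ)).continuousAt
    have hlim : Tendsto (fun y => 2 * δ + (normalCDF (((k : ℝ) - μ) / σ) - normalCDF y))
        (𝓝[<] (((k : ℝ) - μ) / σ)) (𝓝 (2 * δ + (normalCDF (((k : ℝ) - μ) / σ) -
          normalCDF (((k : ℝ) - μ) / σ)))) :=
      (hcont.tendsto.mono_left nhdsWithin_le_nhds).const_sub _ |>.const_add _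
    rw [sub_self, add_zero] at hlim
    exact ge_of_tendsto hlim (eventually_nhdsWithin_of_forall hε)
  set F : Finset ℤ := Finset.Icc ⌈μ - 2 * σ⌉ ⌊μ + 2 * σ⌋
  have hcard : (F.card : ℝ) ≤ 4 * σ + 1 := by
    have h1 := Int.ceil_lt_add_one (μ - 2 * σ)
    have h2 := Int.floor_le (μ + 2 * σ)
    have h3 := Int.le_ceil (μ - 2 * σ)
    rw [Int.card_Icc]
    have : (((⌊μ + 2 * σ⌋ + 1 - ⌈μ - 2 * σ⌉).toNat : ℤ) : ℝ) ≤ 4 * σ + 1 := by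
      rw [Int.toNat_eq_max]
      push_cast
      exact max_le (by linarith) (by linarith)
    exact_mod_cast this
  -- Chebyshev's inequality in integrated form: this integrand lies below the indicator of `|S - μ|
  -- ≤ 2 * σ`.
  have hleft : ∫ ω, (1 - ((∑ i ∈ s, Z i ω : ℕ) - μ) ^ 2 / (4 * σ ^ 2)) ∂P = 3 / 4 := by
    rw [integral_sub (integrable_const _)
      (h.integrable_sum s fun n => ((n : ℝ) - μ) ^ 2 / (4 * σ ^ 2)), integral_div,
      h.integral_sub_mean_sq, hv]
    simp
    field_simp
    norm_num
  rw [← hleft]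
  calc _ ≤ ∫ ω, ∑ k ∈ F, (if ((∑ i ∈ s, Z i ω : ℕ) : ℤ) = k then (1 : ℝ) else 0) ∂P := by
        refine integral_mono (h.integrable_sum s fun n => 1 - ((n : ℝ) - μ) ^ 2 / (4 * σ ^ 2))
          (h.integrable_sum s fun n => ∑ k ∈ F, if (n : ℤ) = k then (1 : ℝ) else 0) fun ω => ?_
        dsimp only
        rw [Finset.sum_ite_eq]
        split_ifs with hF
        · have : 0 ≤ ((∑ i ∈ s, Z i ω : ℕ) - μ) ^ 2 / (4 * σ ^ 2) := by positivity
          linarith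
        · rw [sub_nonpos, one_le_div (by positivity)]
          have : ¬ |((∑ i ∈ s, Z i ω : ℕ) : ℝ) - μ| ≤ 2 * σ := by
            intro hab
            rw [abs_le] at hab
            refine hF (Finset.mem_Icc.2 ⟨Int.ceil_le.2 ?_, Int.le_floor.2 ?_⟩)
            · rw [Int.cast_natCast]; linarith
            · rw [Int.cast_natCast]; linarith
          push Not at this
          rw [← sq_abs (_ - _)]
          nlinarith
    _ = ∑ k ∈ F, P.real {ω | ((∑ i ∈ s, Z i ω : ℕ) : ℤ) = k} := by
        rw [integral_finsetSum]
        · exact Finset.sum_congr rfl fun k _ => h.integral_ite_sum s fun n => (n : ℤ) = k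
        · exact fun k _ => h.integrable_sum s fun n => if (n : ℤ) = k then (1 : ℝ) else 0
    _ ≤ F.card • (2 * δ) := Finset.sum_le_card_nsmul _ _ _ fun k _ => hatom k
    _ ≤ (4 * σ + 1) * (2 * δ) := by
        rw [nsmul_eq_mul]
        gcongr

end IsBernoulliFamily
end NoisyGraph

/-! ### Kolmogorov distance and the edge discrepancy. -/

namespace NoisyGraph

theorem ksDist_le {μ ν : Measure ℝ} {C : ℝ}
    (h : ∀ x, |μ.real (Set.Iic x) - ν.real (Set.Iic x)| ≤ C) : ksDist μ ν ≤ C :=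
  ciSup_le h

/-- A real supremum of an unbounded family is 0 by convention, so the bound 1 is needed here. -/
theorem le_ksDist (μ ν : Measure ℝ) [IsProbabilityMeasure μ] [IsProbabilityMeasure ν] (x : ℝ) :
    |μ.real (Set.Iic x) - ν.real (Set.Iic x)| ≤ ksDist μ ν := by
  refine le_ciSup (f := fun x => |μ.real (Set.Iic x) - ν.real (Set.Iic x)|) ⟨1, ?_⟩ x
  rintro _ ⟨y, rfl⟩
  dsimp only
  have h1 : μ.real (Set.Iic y) ≤ 1 := measureReal_le_one
  have h2 : ν.real (Set.Iic y) ≤ 1 := measureReal_le_one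
  have h3 : 0 ≤ μ.real (Set.Iic y) := measureReal_nonneg
  have h4 : 0 ≤ ν.real (Set.Iic y) := measureReal_nonneg
  rw [abs_le]
  constructor <;> linarith

section Difference

theorem real_prod_eq_integral (μ ν : Measure ℕ) [IsProbabilityMeasure μ] [IsProbabilityMeasure ν]
    (A : Set (ℕ × ℕ)) : (μ.prod ν).real A = ∫ i, ν.real {j | (i, j) ∈ A} ∂μ := by
  rw [measureReal_def, Measure.prod_apply .of_discrete, ← integral_toReal]
  · rfl
  · exact (measurable_of_countable _).aemeasurable
  · exact ae_of_all _ fun i => measure_lt_top _ _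

theorem real_prod_eq_integral_symm (μ ν : Measure ℕ) [IsProbabilityMeasure μ]
    [IsProbabilityMeasure ν] (A : Set (ℕ × ℕ)) :
    (μ.prod ν).real A = ∫ j, μ.real {i | (i, j) ∈ A} ∂ν := by
  rw [measureReal_def, Measure.prod_apply_symm .of_discrete, ← integral_toReal]
  · rfl
  · exact (measurable_of_countable _).aemeasurable
  · exact ae_of_all _ fun i => measure_lt_top _ _

theorem abs_integral_sub_integral_le {μ : Measure ℕ} [IsProbabilityMeasure μ]
    {f g : ℕ → ℝ} {C δ : ℝ}
    (hf : ∀ i, |f i| ≤ C) (hg : ∀ i, |g i| ≤ C) (h : ∀ i, |f i - g i| ≤ δ) :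
    |∫ i, f i ∂μ - ∫ i, g i ∂μ| ≤ δ := by
  rw [← integral_sub
    (Integrable.of_bound (measurable_of_countable f).aestronglyMeasurable C (ae_of_all _ hf))
    (Integrable.of_bound (measurable_of_countable g).aestronglyMeasurable C (ae_of_all _ hg)),
    ← Real.norm_eq_abs]
  exact (norm_integral_le_of_norm_le_const (ae_of_all _ h)).trans (by simp)

theorem abs_real_le_one {α : Type*} [MeasurableSpace α] (μ : Measure α) [IsProbabilityMeasure μ]
    (A : Set α) : |μ.real A| ≤ 1 := by
  rw [abs_of_nonneg measureReal_nonneg]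
  exact measureReal_le_one

/-- Conditioning one coordinate of a difference shifts the threshold, possibly below 0, where both
events are empty. -/
theorem abs_real_int_le_sub_le {μ μ' : Measure ℕ} {δ : ℝ} (hδ0 : 0 ≤ δ)
    (hδ : ∀ k, |μ.real {i | i ≤ k} - μ'.real {i | i ≤ k}| ≤ δ) (t : ℤ) :
    |μ.real {i | (i : ℤ) ≤ t} - μ'.real {i | (i : ℤ) ≤ t}| ≤ δ := by
  obtain ht | ht := lt_or_ge t 0
  · have : {i : ℕ | (i : ℤ) ≤ t} = ∅ := by
      ext i
      simp only [Set.mem_ofPred_eq, Set.mem_empty_iff_false, iff_false]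
      omega
    simpa [this] using hδ0
  · lift t to ℕ using ht
    simpa using hδ t

/-- Replacing independent variables by others with close distribution functions changes the
distribution function of the difference only a little. -/
theorem abs_real_prod_sub_le {μ μ' ν ν' : Measure ℕ} [IsProbabilityMeasure μ]
    [IsProbabilityMeasure μ'] [IsProbabilityMeasure ν] [IsProbabilityMeasure ν'] {δ ε : ℝ}
    (hδ : ∀ k, |μ.real {i | i ≤ k} - μ'.real {i | i ≤ k}| ≤ δ)
    (hε : ∀ k, |ν.real {i | i ≤ k} - ν'.real {i | i ≤ k}| ≤ ε) (t : ℤ) :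
    |(μ.prod ν).real {q : ℕ × ℕ | (q.1 : ℤ) - q.2 ≤ t} -
      (μ'.prod ν').real {q : ℕ × ℕ | (q.1 : ℤ) - q.2 ≤ t}| ≤ δ + ε := by
  have hδ0 := (abs_nonneg _).trans (hδ 0)
  have hε0 := (abs_nonneg _).trans (hε 0)
  -- One coordinate is replaced at a time, conditionally on the other.
  refine (abs_sub_le _ ((μ'.prod ν).real {q : ℕ × ℕ | (q.1 : ℤ) - q.2 ≤ t}) _).trans
    (add_le_add ?_ ?_)
  · rw [real_prod_eq_integral_symm, real_prod_eq_integral_symm]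
    refine abs_integral_sub_integral_le (fun _ => abs_real_le_one _ _)
      (fun _ => abs_real_le_one _ _) fun j => ?_
    simpa [sub_le_iff_le_add] using abs_real_int_le_sub_le hδ0 hδ (t + j)
  · rw [real_prod_eq_integral, real_prod_eq_integral]
    refine abs_integral_sub_integral_le (fun _ => abs_real_le_one _ _)
      (fun _ => abs_real_le_one _ _) fun i => ?_
    -- The second coordinate enters with a minus sign, so its event is an upper tail.
    have hc : {j : ℕ | (i, j) ∈ {q : ℕ × ℕ | (q.1 : ℤ) - q.2 ≤ t}} =
        {j : ℕ | (j : ℤ) ≤ i - t - 1}ᶜ := by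
      ext j
      simp only [Set.mem_ofPred_eq, Set.mem_compl_iff]
      omega
    rw [hc, probReal_compl_eq_one_sub .of_discrete, probReal_compl_eq_one_sub .of_discrete,
      sub_sub_sub_cancel_left, abs_sub_comm]
    exact abs_real_int_le_sub_le hε0 hε _

end Difference

section Graph

variable {V : Type*} [Fintype V] [DecidableEq V] {Ω : Type*} {G : SimpleGraph V}
  {Y : VPair V → Ω → Bool} {α β : VPair V → ℝ} {l : ℝ}

theorem sum_nonEdges_add_sum_edges (G : SimpleGraph V) (f : VPair V → ℝ) :
    ∑ e ∈ nonEdges G, f e + ∑ e ∈ edges G, f e = ∑ e, f e :=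
  Finset.sum_sdiff (Finset.subset_univ (edges G))

theorem sum_nonEdges_ite (f g : VPair V → ℝ) :
    ∑ e ∈ nonEdges G, (if e ∈ edges G then f e else g e) = ∑ e ∈ nonEdges G, g e :=
  Finset.sum_congr rfl fun _ he => if_neg (Finset.mem_sdiff.1 he).2

theorem sum_edges_ite (f g : VPair V → ℝ) :
    ∑ e ∈ edges G, (if e ∈ edges G then f e else g e) = ∑ e ∈ edges G, f e :=
  Finset.sum_congr rfl fun _ he => if_pos he

/-- The error indicators of the pairs. -/
noncomputable def errorIndicator (G : SimpleGraph V) (Y : VPair V → Ω → Bool)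
    (e : VPair V) (ω : Ω) : ℕ :=
  if e ∈ edges G then (!Y e ω).toNat else (Y e ω).toNat

/-- False positives add to the edge count and false negatives remove from it. This form serves the
Skellam approximation. -/
theorem edgeDiscrepancy_eq_sub (ω : Ω) : edgeDiscrepancy G Y ω =
    ((∑ e ∈ nonEdges G, errorIndicator G Y e ω : ℕ) : ℤ) -
      (∑ e ∈ edges G, errorIndicator G Y e ω : ℕ) := by
  have h1 : ((inferredEdges Y ω).card : ℤ) = ∑ e, ((Y e ω).toNat : ℤ) := by
    rw [inferredEdges, Finset.card_filter]
    push_cast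
    refine Finset.sum_congr rfl fun e _ => ?_
    cases Y e ω <;> rfl
  have h2 : ∑ e ∈ nonEdges G, (errorIndicator G Y e ω : ℤ) =
      ∑ e ∈ nonEdges G, ((Y e ω).toNat : ℤ) := by
    refine Finset.sum_congr rfl fun e he => ?_
    rw [errorIndicator, if_neg (Finset.mem_sdiff.1 he).2]
  have h3 : ∑ e ∈ edges G, (errorIndicator G Y e ω : ℤ) =
      (edges G).card - ∑ e ∈ edges G, ((Y e ω).toNat : ℤ) := by
    rw [eq_sub_iff_add_eq, ← Finset.sum_add_distrib, Finset.card_eq_sum_ones]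
    push_cast
    refine Finset.sum_congr rfl fun e he => ?_
    rw [errorIndicator, if_pos he]
    cases Y e ω <;> rfl
  push_cast
  rw [edgeDiscrepancy, h1, h2, h3, nonEdges, ← Finset.sum_sdiff (Finset.subset_univ (edges G))]
  ring

theorem errorIndicator_le_one (e : VPair V) (ω : Ω) : errorIndicator G Y e ω ≤ 1 := by
  unfold errorIndicator
  split_ifs
  · exact Bool.toNat_le _
  · exact Bool.toNat_le _

/-- Unbiasedness says that the expected number of inferred edges is `|E|`. This form, a single
centred sum, serves the normal approximation. -/
theorem edgeDiscrepancy_eq_sum_sub (hαl : ∑ e ∈ nonEdges G, α e = l)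
    (hβl : ∑ e ∈ edges G, β e = l) (ω : Ω) : (edgeDiscrepancy G Y ω : ℝ) =
      ((∑ e, (Y e ω).toNat : ℕ) : ℝ) - ∑ e, if e ∈ edges G then 1 - β e else α e := by
  have h1 : (inferredEdges Y ω).card = ∑ e, (Y e ω).toNat := by
    rw [inferredEdges, Finset.card_filter]
    refine Finset.sum_congr rfl fun e _ => ?_
    cases Y e ω <;> rfl
  have h2 : (∑ e, if e ∈ edges G then 1 - β e else α e) = ((edges G).card : ℝ) := by
    rw [← sum_nonEdges_add_sum_edges G, sum_nonEdges_ite, sum_edges_ite, Finset.sum_sub_distrib,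
      hαl, hβl]
    simp
  rw [edgeDiscrepancy, h1, h2]
  push_cast
  rfl

theorem sum_mul_one_sub_eq : (∑ e, (if e ∈ edges G then 1 - β e else α e) *
      (1 - if e ∈ edges G then 1 - β e else α e)) =
    ∑ e ∈ nonEdges G, α e * (1 - α e) + ∑ e ∈ edges G, β e * (1 - β e) := by
  have h : ∀ e, (if e ∈ edges G then 1 - β e else α e) *
      (1 - if e ∈ edges G then 1 - β e else α e) =
      if e ∈ edges G then β e * (1 - β e) else α e * (1 - α e) := by
    intro e
    split_ifs <;> ring
  simp_rw [h]
  rw [← sum_nonEdges_add_sum_edges G, sum_nonEdges_ite, sum_edges_ite]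

variable [MeasurableSpace Ω] {P : Measure Ω}

theorem measurable_edgeDiscrepancy (hY : ∀ e, Measurable (Y e)) :
    Measurable fun ω => (edgeDiscrepancy G Y ω : ℝ) := by
  have : (fun ω => (edgeDiscrepancy G Y ω : ℝ)) =
      fun ω => ∑ e, (if Y e ω = true then (1 : ℝ) else 0) - ((edges G).card : ℝ) := by
    ext ω
    simp [edgeDiscrepancy, inferredEdges]
  rw [this]
  refine (Finset.measurable_sum _ fun e _ => ?_).sub_const _
  exact (measurable_of_countable fun b : Bool => if b = true then (1 : ℝ) else 0).comp (hY e)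

theorem measurable_errorIndicator (hY : ∀ e, Measurable (Y e)) (e : VPair V) :
    Measurable (errorIndicator G Y e) :=
  (measurable_of_countable fun b : Bool => if e ∈ edges G then (!b).toNat else b.toNat).comp (hY e)

theorem iIndepFun_errorIndicator (hind : iIndepFun Y P) : iIndepFun (errorIndicator G Y) P :=
  hind.comp (fun e b => if e ∈ edges G then (!b).toNat else b.toNat)
    fun _ => measurable_of_countable _

theorem isBernoulliFamily_nonEdges (hY : ∀ e, Measurable (Y e)) (hind : iIndepFun Y P)
    (hα : ∀ e ∈ nonEdges G, P.real {ω | Y e ω = true} = α e) :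
    IsBernoulliFamily P (nonEdges G) (errorIndicator G Y) α where
  measurable := measurable_errorIndicator hY
  le_one := errorIndicator_le_one
  iIndepFun := iIndepFun_errorIndicator hind
  prob e he := by
    rw [← hα e he]
    simp only [errorIndicator, if_neg (Finset.mem_sdiff.1 he).2, Bool.toNat_eq_one]

theorem isBernoulliFamily_edges [IsProbabilityMeasure P] (hY : ∀ e, Measurable (Y e))
    (hind : iIndepFun Y P) (hβ : ∀ e ∈ edges G, P.real {ω | Y e ω = true} = 1 - β e) :
    IsBernoulliFamily P (edges G) (errorIndicator G Y) β where
  measurable := measurable_errorIndicator hY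
  le_one := errorIndicator_le_one
  iIndepFun := iIndepFun_errorIndicator hind
  prob e he := by
    have h1 : {ω | errorIndicator G Y e ω = 1} = {ω | Y e ω = true}ᶜ := by
      ext ω
      simp [errorIndicator, if_pos he]
    have h2 : MeasurableSet {ω | Y e ω = true} := hY e (measurableSet_singleton true)
    rw [h1, probReal_compl_eq_one_sub h2, hβ e he]
    ring

/-- The pairs that are declared to be edges form a Bernoulli family. -/
theorem isBernoulliFamily_univ (hY : ∀ e, Measurable (Y e)) (hind : iIndepFun Y P)
    (hα : ∀ e ∈ nonEdges G, P.real {ω | Y e ω = true} = α e)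
    (hβ : ∀ e ∈ edges G, P.real {ω | Y e ω = true} = 1 - β e) :
    IsBernoulliFamily P Finset.univ (fun e ω => (Y e ω).toNat)
      (fun e => if e ∈ edges G then 1 - β e else α e) where
  measurable e := (measurable_of_countable Bool.toNat).comp (hY e)
  le_one _ _ := Bool.toNat_le _
  iIndepFun := hind.comp (fun _ => Bool.toNat) fun _ => measurable_of_countable _
  prob e _ := by
    simp only [Bool.toNat_eq_one]
    split_ifs with he
    · exact hβ e he
    · exact hα e (Finset.mem_sdiff.2 ⟨Finset.mem_univ e, he⟩)

theorem real_lawStandardizedD_Iic (hY : ∀ e, Measurable (Y e))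
    (hαl : ∑ e ∈ nonEdges G, α e = l) (hβl : ∑ e ∈ edges G, β e = l) (x : ℝ) :
    (lawStandardizedD P G Y).real (Set.Iic x) = P.real {ω | (((∑ e, (Y e ω).toNat : ℕ) : ℝ) -
      ∑ e, if e ∈ edges G then 1 - β e else α e) / sigma P G Y ≤ x} := by
  rw [lawStandardizedD,
    map_measureReal_apply ((measurable_edgeDiscrepancy hY).div_const _) measurableSet_Iic]
  congr 1
  ext ω
  simp only [Set.mem_preimage, Set.mem_Iic, Set.mem_ofPred_eq, edgeDiscrepancy_eq_sum_sub hαl hβl]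

variable [IsProbabilityMeasure P]

/-- The Skellam approximation of the edge discrepancy. -/
theorem ksDist_lawD_skellam_le (hY : ∀ e, Measurable (Y e)) (hind : iIndepFun Y P)
    (hα : ∀ e ∈ nonEdges G, P.real {ω | Y e ω = true} = α e)
    (hβ : ∀ e ∈ edges G, P.real {ω | Y e ω = true} = 1 - β e)
    (hαl : ∑ e ∈ nonEdges G, α e = l) (hβl : ∑ e ∈ edges G, β e = l) (hl : 0 < l) :
    ksDist (lawD P G Y) ((skellam l l).map fun j : ℤ => (j : ℝ)) ≤
      (∑ e ∈ nonEdges G, α e ^ 2) / l + (∑ e ∈ edges G, β e ^ 2) / l := by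
  have hX := isBernoulliFamily_nonEdges hY hind hα
  have hW := isBernoulliFamily_edges hY hind hβ
  set X : Ω → ℕ := fun ω => ∑ e ∈ nonEdges G, errorIndicator G Y e ω with hXdef
  set W : Ω → ℕ := fun ω => ∑ e ∈ edges G, errorIndicator G Y e ω with hWdef
  have hXm : Measurable X := hX.measurable_sum _
  have hWm : Measurable W := hW.measurable_sum _
  -- The two sums run over disjoint sets of pairs.
  have hXW : IndepFun X W P := by
    have h1 := hX.iIndepFun.indepFun_finset (nonEdges G) (edges G) Finset.sdiff_disjoint
      hX.measurable
    have h2 := h1.comp (measurable_of_countable fun v : nonEdges G → ℕ => ∑ i, v i)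
      (measurable_of_countable fun v : edges G → ℕ => ∑ i, v i)
    convert h2 using 1
    · ext ω
      exact (Finset.sum_coe_sort (nonEdges G) fun e => errorIndicator G Y e ω).symm
    · ext ω
      exact (Finset.sum_coe_sort (edges G) fun e => errorIndicator G Y e ω).symm
  have := Measure.isProbabilityMeasure_map (μ := P) hXm.aemeasurable
  have := Measure.isProbabilityMeasure_map (μ := P) hWm.aemeasurable
  have hmap : P.map (fun ω => (X ω, W ω)) = (P.map X).prod (P.map W) :=
    (indepFun_iff_map_prod_eq_prod_map_map hXm.aemeasurable hWm.aemeasurable).1 hXW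
  lift l to ℝ≥0 using hl.le
  have hl' : 0 < l := by exact_mod_cast hl
  refine ksDist_le fun x => ?_
  have hD : (lawD P G Y).real (Set.Iic x) =
      ((P.map X).prod (P.map W)).real {q : ℕ × ℕ | (q.1 : ℤ) - q.2 ≤ ⌊x⌋} := by
    rw [← hmap, map_measureReal_apply (hXm.prodMk hWm) .of_discrete, lawD,
      map_measureReal_apply (measurable_edgeDiscrepancy hY) measurableSet_Iic]
    congr 1
    ext ω
    simp only [Set.mem_preimage, Set.mem_Iic, Set.mem_ofPred_eq, Int.le_floor,
      edgeDiscrepancy_eq_sub]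
    rfl
  have hS : ((skellam l l).map fun j : ℤ => (j : ℝ)).real (Set.Iic x) =
      ((poissonMeasure l).prod (poissonMeasure l)).real
        {q : ℕ × ℕ | (q.1 : ℤ) - q.2 ≤ ⌊x⌋} := by
    rw [skellam_eq_map_poisson l l hl' hl',
      map_measureReal_apply (measurable_of_countable _) measurableSet_Iic,
      map_measureReal_apply (measurable_of_countable _) .of_discrete]
    congr 1
    ext q
    simp only [Set.mem_preimage, Set.mem_Iic, Set.mem_ofPred_eq, Int.le_floor]
  rw [hD, hS]
  refine abs_real_prod_sub_le (fun k => ?_) (fun k => ?_) _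
  · rw [measureReal_poissonMeasure_Iic, map_measureReal_apply hXm .of_discrete, ← hαl]
    exact hX.abs_cdf_sub_poissonCDF_le (hαl ▸ hl) k
  · rw [measureReal_poissonMeasure_Iic, map_measureReal_apply hWm .of_discrete, ← hβl]
    exact hW.abs_cdf_sub_poissonCDF_le (hβl ▸ hl) k

theorem sigma_sq (hY : ∀ e, Measurable (Y e)) (hind : iIndepFun Y P)
    (hα : ∀ e ∈ nonEdges G, P.real {ω | Y e ω = true} = α e)
    (hβ : ∀ e ∈ edges G, P.real {ω | Y e ω = true} = 1 - β e)
    (hαl : ∑ e ∈ nonEdges G, α e = l) (hβl : ∑ e ∈ edges G, β e = l) :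
    sigma P G Y ^ 2 =
      ∑ e ∈ nonEdges G, α e * (1 - α e) + ∑ e ∈ edges G, β e * (1 - β e) := by
  have h := isBernoulliFamily_univ hY hind hα hβ
  rw [sigma, Real.sq_sqrt (variance_nonneg _ _)]
  have hmean : ∫ ω, (edgeDiscrepancy G Y ω : ℝ) ∂P = 0 := by
    -- A constant test function has zero increments, so the centred sum has mean 0.
    have := h.stein_identity fun _ => 1
    simp_rw [edgeDiscrepancy_eq_sum_sub hαl hβl]
    simpa using this
  rw [variance_eq_integral (measurable_edgeDiscrepancy hY).aemeasurable, hmean,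
    ← sum_mul_one_sub_eq, ← h.integral_sub_mean_sq]
  simp_rw [edgeDiscrepancy_eq_sum_sub hαl hβl, sub_zero]

/-- The Berry–Esseen bound for the edge discrepancy. -/
theorem ksDist_lawStandardizedD_le (hY : ∀ e, Measurable (Y e)) (hind : iIndepFun Y P)
    (hα : ∀ e ∈ nonEdges G, P.real {ω | Y e ω = true} = α e)
    (hβ : ∀ e ∈ edges G, P.real {ω | Y e ω = true} = 1 - β e)
    (hαl : ∑ e ∈ nonEdges G, α e = l) (hβl : ∑ e ∈ edges G, β e = l) (hσ : 0 < sigma P G Y) :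
    ksDist (lawStandardizedD P G Y) (gaussianReal 0 1) ≤ 12 / sigma P G Y := by
  refine ksDist_le fun x => ?_
  rw [real_lawStandardizedD_Iic hY hαl hβl]
  refine (isBernoulliFamily_univ hY hind hα hβ).abs_cdf_sub_normalCDF_le hσ ?_ x
  rw [sigma_sq hY hind hα hβ hαl hβl, sum_mul_one_sub_eq]

/-- The lower bound for the normal approximation of the edge discrepancy. -/
theorem le_ksDist_lawStandardizedD (hY : ∀ e, Measurable (Y e)) (hind : iIndepFun Y P)
    (hα : ∀ e ∈ nonEdges G, P.real {ω | Y e ω = true} = α e)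
    (hβ : ∀ e ∈ edges G, P.real {ω | Y e ω = true} = 1 - β e)
    (hαl : ∑ e ∈ nonEdges G, α e = l) (hβl : ∑ e ∈ edges G, β e = l) (hσ : 0 < sigma P G Y) :
    3 / 4 ≤ (4 * sigma P G Y + 1) *
      (2 * ksDist (lawStandardizedD P G Y) (gaussianReal 0 1)) := by
  refine (isBernoulliFamily_univ hY hind hα hβ).le_of_abs_cdf_sub_normalCDF_le hσ ?_ fun x => ?_
  · rw [sigma_sq hY hind hα hβ hαl hβl, sum_mul_one_sub_eq]
  · have hm : Measurable fun ω => (edgeDiscrepancy G Y ω : ℝ) / sigma P G Y :=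
      (measurable_edgeDiscrepancy hY).div_const _
    have : IsProbabilityMeasure (lawStandardizedD P G Y) :=
      Measure.isProbabilityMeasure_map hm.aemeasurable
    rw [← real_lawStandardizedD_Iic hY hαl hβl]
    exact le_ksDist _ _ x

end Graph
end NoisyGraph

/-! ### Asymptotics and the main theorem. -/

namespace NoisyGraph

theorem card_edges_add_card_nonEdges {V : Type*} [Fintype V] [DecidableEq V] (G : SimpleGraph V) :
    ((edges G).card : ℝ) + (nonEdges G).card =
      (Fintype.card V : ℝ) * ((Fintype.card V : ℝ) - 1) / 2 := by
  have h1 : (nonEdges G).card + (edges G).card = Fintype.card (VPair V) :=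
    Finset.card_sdiff_add_card_eq_card (Finset.subset_univ (edges G))
  have h2 : Fintype.card (VPair V) = (Fintype.card V).choose 2 := by
    rw [← Sym2.card_subtype_not_diag]
  rw [add_comm, ← Nat.cast_choose_two, ← h2, ← h1]
  push_cast
  rfl

theorem isLittleO_rpow_mul_log_rpow {γ : ℝ} (hγ : γ < 1) (κ : ℝ) :
    (fun x : ℝ => x ^ γ * Real.log x ^ κ) =o[atTop] fun x => x := by
  have h := (isBigO_refl (fun x : ℝ => x ^ γ) atTop).mul_isLittleO
    (isLittleO_log_rpow_rpow_atTop κ (sub_pos.2 hγ))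
  refine h.congr' EventuallyEq.rfl ?_
  filter_upwards [eventually_gt_atTop 0] with x hx
  rw [← Real.rpow_add hx, add_sub_cancel, Real.rpow_one]

/-- This turns the Barbour–Hall bound into the common error probability. -/
theorem sum_sq_div_eq {ι : Type*} {s : Finset ι} {p : ι → ℝ} {a l : ℝ} (hp : ∀ e ∈ s, p e = a)
    (hl : ∑ e ∈ s, p e = l) (h0 : l ≠ 0) : (∑ e ∈ s, p e ^ 2) / l = a := by
  rw [Finset.sum_congr rfl fun e he => by rw [pow_two, hp e he, ← hp e he],
    div_eq_iff h0, ← hl, Finset.mul_sum]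
  exact Finset.sum_congr rfl fun e he => by rw [hp e he]

theorem sum_mul_one_sub_const {ι : Type*} {s : Finset ι} {p : ι → ℝ} {a l : ℝ}
    (hp : ∀ e ∈ s, p e = a) (hl : ∑ e ∈ s, p e = l) :
    ∑ e ∈ s, p e * (1 - p e) = l * (1 - a) := by
  rw [← hl, Finset.sum_mul]
  exact Finset.sum_congr rfl fun e he => by rw [hp e he]

end NoisyGraph

open NoisyGraph

/-- `V k`, `G k`, `Y k` is a sequence of noisily observed graphs, with `n_v = |V k|`. -/
theorem theorem1
    {V : ℕ → Type*} [∀ k, Fintype (V k)] [∀ k, DecidableEq (V k)]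
    {Ω : ℕ → Type*} [∀ k, MeasurableSpace (Ω k)]
    (P : ∀ k, Measure (Ω k)) [∀ k, IsProbabilityMeasure (P k)]
    (G : ∀ k, SimpleGraph (V k))
    (Y : ∀ k, NoisyGraph.VPair (V k) → Ω k → Bool)
    (hYmeas : ∀ k e, Measurable (Y k e))
    (α β : ∀ k, NoisyGraph.VPair (V k) → ℝ)
    -- the marginal distributions of the error indicators
    (hα : ∀ k, ∀ e ∈ NoisyGraph.nonEdges (G k), (P k).real {ω | Y k e ω = true} = α k e)
    (hβ : ∀ k, ∀ e ∈ NoisyGraph.edges (G k), (P k).real {ω | Y k e ω = true} = 1 - β k e)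
    -- independence
    (hindep : ∀ k, iIndepFun (Y k) (P k))
    (lam : ℕ → ℝ) (γ κ : ℝ)
    -- large graphs
    (A1 : Tendsto (fun k => Fintype.card (V k)) atTop atTop)
    -- sparse graphs
    (A2 : (fun k => ((NoisyGraph.edges (G k)).card : ℝ)) =Θ[atTop]
      fun k => (Fintype.card (V k) : ℝ) * Real.log (Fintype.card (V k)))
    -- edge unbiasedness
    (A3 : ∀ k, ∑ e ∈ NoisyGraph.nonEdges (G k), α k e = lam k ∧
      ∑ e ∈ NoisyGraph.edges (G k), β k e = lam k)
    -- low error rate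
    (hγ : γ ∈ Set.Ico (0 : ℝ) 1) (hκ : 0 ≤ κ)
    (A4 : lam =Θ[atTop]
      fun k => (Fintype.card (V k) : ℝ) ^ γ * Real.log (Fintype.card (V k)) ^ κ)
    -- homogeneity
    (A5 : ∀ k, ∃ a ∈ Set.Ioo (0 : ℝ) 1, ∃ b ∈ Set.Ioo (0 : ℝ) 1,
      (∀ e ∈ NoisyGraph.nonEdges (G k), α k e = a) ∧
      (∀ e ∈ NoisyGraph.edges (G k), β k e = b)) :
    ((fun k => NoisyGraph.ksDist (NoisyGraph.lawD (P k) (G k) (Y k))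
        ((NoisyGraph.skellam (lam k) (lam k)).map (fun j : ℤ => (j : ℝ)))) =O[atTop]
      fun k => ((Fintype.card (V k) : ℝ) ^ (1 - γ) *
        Real.log (Fintype.card (V k)) ^ (1 - κ))⁻¹) ∧
    ((fun k => NoisyGraph.ksDist (NoisyGraph.lawStandardizedD (P k) (G k) (Y k))
        (gaussianReal 0 1)) =O[atTop]
      fun k => ((Fintype.card (V k) : ℝ) ^ (γ / 2) *
        Real.log (Fintype.card (V k)) ^ (κ / 2))⁻¹) ∧
    (∃ c : ℝ, 0 < c ∧ ∀ᶠ k in atTop,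
      c * ((Fintype.card (V k) : ℝ) * Real.log (Fintype.card (V k)))⁻¹ ≤
        NoisyGraph.ksDist (NoisyGraph.lawStandardizedD (P k) (G k) (Y k))
          (gaussianReal 0 1)) := by
  set n : ℕ → ℝ := fun k => (Fintype.card (V k) : ℝ) with hn
  have hntop : Tendsto n atTop atTop := tendsto_natCast_atTop_atTop.comp A1
  have hbig : ∀ᶠ k in atTop, 4 ≤ n k ∧ 1 ≤ Real.log (n k) :=
    (hntop.eventually_ge_atTop 4).and ((Real.tendsto_log_atTop.comp hntop).eventually_ge_atTop 1)
  have hlam0 : ∀ k, 0 ≤ lam k := fun k => by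
    rw [← (A3 k).1]
    exact Finset.sum_nonneg fun e he => hα k e he ▸ measureReal_nonneg
  -- The lower half of the Θ in `A4` forbids zeros where the comparison function is positive.
  have hlam : ∀ᶠ k in atTop, 0 < lam k := by
    filter_upwards [A4.2.eq_zero_imp, hbig] with k h ⟨hk, hL⟩
    refine (hlam0 k).lt_of_ne' fun h0 => ?_
    have hk0 : 0 < n k := by linarith
    have hL0 : 0 < Real.log (n k) := by linarith
    have : 0 < n k ^ γ * Real.log (n k) ^ κ := by positivity
    exact this.ne' (h h0)
  have hlam_n : lam =o[atTop] n :=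
    A4.1.trans_isLittleO ((isLittleO_rpow_mul_log_rpow hγ.2 κ).comp_tendsto hntop)
  have hn_m : n =O[atTop] fun k => ((edges (G k)).card : ℝ) := by
    refine IsBigO.trans (IsBigO.of_bound 1 ?_) A2.2
    filter_upwards [hbig] with k hk
    rw [Real.norm_of_nonneg (by linarith), Real.norm_of_nonneg (by nlinarith)]
    nlinarith
  have hm_sq : (fun k => ((edges (G k)).card : ℝ)) =o[atTop] fun k => n k * n k :=
    A2.1.trans_isLittleO
      ((isBigO_refl n atTop).mul_isLittleO (Real.isLittleO_log_id_atTop.comp_tendsto hntop))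
  -- With `|E| ≤ n² / 8` and `n ≥ 4`, the non-edges number at least `3n² / 8 - n² / 8`, hence at
  -- least `|E|`. The factor 1/2 will give `b ≤ 1 / 2`.
  have hfacts : ∀ᶠ k in atTop, 0 < lam k ∧ lam k ≤ n k ∧
      lam k ≤ 1 / 2 * (edges (G k)).card ∧ ((edges (G k)).card : ℝ) ≤ (nonEdges (G k)).card := by
    filter_upwards [hlam, hlam_n.bound one_pos,
      (hlam_n.trans_isBigO hn_m).bound (c := 1 / 2) (by norm_num),
      hm_sq.bound (c := 1 / 8) (by norm_num), hbig] with k h0 h1 h2 h3 h4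
    have h5 := card_edges_add_card_nonEdges (G k)
    rw [Real.norm_of_nonneg (hlam0 k), Real.norm_of_nonneg (by linarith)] at h1
    rw [Real.norm_of_nonneg (hlam0 k), Real.norm_of_nonneg (by positivity)] at h2
    rw [Real.norm_of_nonneg (by positivity), Real.norm_of_nonneg (by nlinarith)] at h3
    refine ⟨h0, by linarith, h2, ?_⟩
    change _ = n k * (n k - 1) / 2 at h5
    nlinarith
  have hrates : ∀ᶠ k in atTop, 0 < lam k ∧ lam k ≤ n k ∧ 0 < ((edges (G k)).card : ℝ) ∧
      (∑ e ∈ nonEdges (G k), α k e ^ 2) / lam k + (∑ e ∈ edges (G k), β k e ^ 2) / lam k ≤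
        2 * (lam k / (edges (G k)).card) ∧
      lam k ≤ sigma (P k) (G k) (Y k) ^ 2 ∧ sigma (P k) (G k) (Y k) ^ 2 ≤ 2 * lam k := by
    filter_upwards [hfacts] with k ⟨h0, h1, h2, h3⟩
    obtain ⟨a, ha, b, hb, hαa, hβb⟩ := A5 k
    obtain ⟨hαl, hβl⟩ := A3 k
    have hm : 0 < ((edges (G k)).card : ℝ) := by linarith
    have hNa : ((nonEdges (G k)).card : ℝ) * a = lam k := by
      rw [← hαl, Finset.sum_congr rfl hαa, Finset.sum_const, nsmul_eq_mul]
    have hmb : ((edges (G k)).card : ℝ) * b = lam k := by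
      rw [← hβl, Finset.sum_congr rfl hβb, Finset.sum_const, nsmul_eq_mul]
    have hb' : b = lam k / (edges (G k)).card := by rw [← hmb]; field_simp
    -- Both totals equal `lam k`, and the larger class has the smaller rate.
    have hab : a ≤ b := by nlinarith [ha.1]
    have hb2 : b ≤ 1 / 2 := by
      rw [hb', div_le_iff₀ hm]; exact h2
    rw [sum_sq_div_eq hαa hαl h0.ne', sum_sq_div_eq hβb hβl h0.ne',
      sigma_sq (hYmeas k) (hindep k) (hα k) (hβ k) hαl hβl,
      sum_mul_one_sub_const hαa hαl, sum_mul_one_sub_const hβb hβl, ← hb']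
    refine ⟨h0, h1, hm, by linarith, ?_, ?_⟩
    · nlinarith
    · nlinarith [ha.1, hb.1]
  have hks : ∀ k, 0 ≤ ksDist (lawD (P k) (G k) (Y k))
      ((skellam (lam k) (lam k)).map (fun j : ℤ => (j : ℝ))) := fun k =>
    Real.iSup_nonneg fun _ => abs_nonneg _
  have hks' : ∀ k, 0 ≤ ksDist (lawStandardizedD (P k) (G k) (Y k)) (gaussianReal 0 1) := fun k =>
    Real.iSup_nonneg fun _ => abs_nonneg _
  -- From `3 / 4 ≤ (4σ + 1) * 2δ` and `4σ + 1 ≤ 5n` one gets `δ ≥ 3 / (40n)`; the logarithm is given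
  -- away.
  refine ⟨?_, ?_, 3 / 40, by norm_num, ?_⟩
  · have h1 : (fun k => ksDist (lawD (P k) (G k) (Y k))
        ((skellam (lam k) (lam k)).map (fun j : ℤ => (j : ℝ)))) =O[atTop]
        fun k => lam k / (edges (G k)).card := by
      refine IsBigO.of_bound 2 ?_
      filter_upwards [hrates] with k ⟨h0, _, hm, h, _, _⟩
      rw [Real.norm_of_nonneg (hks k), Real.norm_of_nonneg (by positivity)]
      exact (ksDist_lawD_skellam_le (hYmeas k) (hindep k) (hα k) (hβ k) (A3 k).1 (A3 k).2 h0).trans h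
    refine h1.trans ((A4.div A2).1.congr' EventuallyEq.rfl ?_)
    filter_upwards [hbig] with k ⟨hk, hL⟩
    have hk0 : 0 < n k := by linarith
    have hL0 : 0 < Real.log (n k) := by linarith
    change n k ^ γ * Real.log (n k) ^ κ / (n k * Real.log (n k)) = _
    rw [Real.rpow_sub hk0, Real.rpow_sub hL0, Real.rpow_one, Real.rpow_one]
    have := Real.rpow_pos_of_pos hk0 γ
    have := Real.rpow_pos_of_pos hL0 κ
    field_simp
  · have h1 : (fun k => ksDist (lawStandardizedD (P k) (G k) (Y k)) (gaussianReal 0 1)) =O[atTop]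
        fun k => (lam k ^ (1 / 2 : ℝ))⁻¹ := by
      refine IsBigO.of_bound 12 ?_
      filter_upwards [hrates] with k ⟨h0, _, _, _, h, _⟩
      rw [Real.norm_of_nonneg (hks' k), ← Real.sqrt_eq_rpow, Real.norm_of_nonneg (by positivity)]
      have hσ : √(lam k) ≤ sigma (P k) (G k) (Y k) :=
        Real.sqrt_le_iff.2 ⟨Real.sqrt_nonneg _, h⟩
      have hl : 0 < √(lam k) := Real.sqrt_pos.2 h0
      refine (ksDist_lawStandardizedD_le (hYmeas k) (hindep k) (hα k) (hβ k) (A3 k).1 (A3 k).2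
        (hl.trans_le hσ)).trans ?_
      rw [div_eq_mul_inv]
      gcongr
    refine h1.trans ?_
    have h2 := (A4.2.rpow (r := 1 / 2) (by norm_num) (Eventually.of_forall hlam0))
    refine (IsBigO.inv_rev h2 ?_).congr' EventuallyEq.rfl ?_
    · filter_upwards [hbig] with k ⟨hk, hL⟩ h
      have hk0 : 0 < n k := by linarith
      have hL0 : 0 < Real.log (n k) := by linarith
      have : 0 < (n k ^ γ * Real.log (n k) ^ κ) ^ (1 / 2 : ℝ) := by positivity
      exact absurd h this.ne'
    · filter_upwards [hbig] with k ⟨hk, hL⟩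
      have hk0 : 0 ≤ n k := by linarith
      have hL0 : 0 ≤ Real.log (n k) := by linarith
      change ((n k ^ γ * Real.log (n k) ^ κ) ^ (1 / 2 : ℝ))⁻¹ = _
      rw [Real.mul_rpow (by positivity) (by positivity), ← Real.rpow_mul hk0, ← Real.rpow_mul hL0,
        mul_one_div, mul_one_div]
  · filter_upwards [hrates, hbig] with k ⟨h0, h1, _, _, h2, h3⟩ ⟨hk, hL⟩
    have hσ0 : 0 ≤ sigma (P k) (G k) (Y k) := Real.sqrt_nonneg _
    have hσ : 0 < sigma (P k) (G k) (Y k) := by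
      refine hσ0.lt_of_ne fun h => ?_
      rw [← h] at h2
      linarith
    have h4 := le_ksDist_lawStandardizedD (hYmeas k) (hindep k) (hα k) (hβ k) (A3 k).1 (A3 k).2 hσ
    have hnL : n k ≤ n k * Real.log (n k) := by nlinarith
    -- `σ² ≤ 2 * lam k ≤ 2n ≤ n²`.
    have h5 : sigma (P k) (G k) (Y k) ≤ n k := by nlinarith
    change 3 / 40 * (n k * Real.log (n k))⁻¹ ≤ _
    rw [← div_eq_mul_inv, div_le_iff₀ (by linarith)]
    nlinarith [hks' k]
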